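/- For $a>-1$ let $\mathbb{H}_a=L^2([0,\infty),e^{-at}\,\mathrm{d}t)$ (real-valued functions), let $K_0(s,t)=e^{-\max(s,t)}-e^{-(s+t)}$ for $s,t>0$, and let $\mathcal{K}_a:\mathbb{H}_a\to\mathbb{H}_a$ be the integral operator $\mathcal{K}_af(s)=\int_0^\infty K_0(s,t)f(t)e^{-at}\,\mathrm{d}t$. Put $\nu=1/(a+1)$ and let $J_\mu(x)=\sum_{m\ge0}\frac{(-1)^m}{m!\,\Gamma(m+\mu+1)}(x/2)^{2m+\mu}$, $x>0$, denote the Bessel function of the first kind. Then the positive zeros of $J_\nu$ form an infinite, strictly increasing sequence $0<z_{\nu,1}<z_{\nu,2}<\dots$ with $J_{\nu-1}(z_{\nu,k})\neq0$ for all $k\ge1$; the operator $\mathcal{K}_a$ is well defined and bounded on $\mathbb{H}_a$; and its eigenvalues are exactly the numbers $$\lambda_k(a)=\Big(\frac{2\nu}{z_{\nu,k}}\Big)^2,\qquad k=1,2,\dots,$$ which are positive and strictly decreasing in $k$. Each eigenvalue $\lambda_k(a)$ is simple, with eigenspace spanned by $$f_{k,a}(t)=\frac{J_\nu\big(z_{\nu,k}e^{-t/(2\nu)}\big)}{\sqrt{\nu}\,J_{\nu-1}(z_{\nu,k})}\,e^{-t/2},\qquad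 t>0,$$ the functions $f_{k,a}$, $k\ge1$, are orthonormal in $\mathbb{H}_a$, and $\int_0^\infty K_0(x,t)f_{k,a}(t)e^{-at}\,\mathrm{d}t=\lambda_k(a)f_{k,a}(x)$ holds for every $x>0$. For $a=1$ and all $k\ge1$ one has $\lambda_k(1)=1/(k\pi)^2$ and $f_{k,1}(t)=(-1)^k\sqrt2\,\sin(k\pi e^{-t})$ for $t>0$; thus $\sin(k\pi e^{-t})$ is an eigenfunction for $\lambda_k(1)$, that is, $\int_0^\infty K_0(x,t)\sin(k\pi e^{-t})e^{-t}\,\mathrm{d}t=\frac1{(k\pi)^2}\sin(k\pi e^{-x})$ for every $x>0$. -/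

import Mathlib

open MeasureTheory Set

noncomputable section

namespace ExpTest

/-- The Bessel function of the first kind `J_ν(x)` of real order `ν` at a real point `x > 0`, by its
power series. (`Real.Gamma` is `0` at the poles of the Gamma function, so that `1 / Γ` has its usual
value `0` there.) -/
def besselJ (ν x : ℝ) : ℝ :=
  ∑' m : ℕ, (-1) ^ m / ((m.factorial : ℝ) * Real.Gamma (m + ν + 1)) * (x / 2) ^ (2 * (m : ℝ) + ν)

/-- `besselZero ν k` is, for `k ≥ 1`, the `k`-th positive zero `z_{ν,k}` of `J_ν` in ascending order;
the recursion starts at `besselZero ν 0 = 0`, which is not counted. -/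
def besselZero (ν : ℝ) : ℕ → ℝ
  | 0 => 0
  | k + 1 => sInf {x : ℝ | besselZero ν k < x ∧ besselJ ν x = 0}

/-- The measure `exp(-a t) dt` on `[0, ∞)`. -/
def weightMeasure (a : ℝ) : Measure ℝ :=
  (volume.restrict (Ici 0)).withDensity fun t => ENNReal.ofReal (Real.exp (-(a * t)))

/-- The Hilbert space `H_a = L²([0, ∞), exp(-a t) dt)`. -/
abbrev Ha (a : ℝ) : Type := Lp ℝ 2 (weightMeasure a)

/-- The covariance kernel `K₀(s, t) = exp(-max(s, t)) - exp(-(s + t))`. -/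
def K0 (s t : ℝ) : ℝ := Real.exp (-max s t) - Real.exp (-(s + t))

/-- The parameter `ν = 1 / (a + 1)`. -/
def order (a : ℝ) : ℝ := (a + 1)⁻¹

/-- `λ_k(a) = (2ν / z_{ν,k})²`. -/
def eigVal (a : ℝ) (k : ℕ) : ℝ := (2 * order a / besselZero (order a) k) ^ 2

/-- `f_{k,a}(t) = J_ν(z_{ν,k} exp(-t / (2ν))) / (√ν J_{ν-1}(z_{ν,k})) · exp(-t / 2)`. -/
def eigFun (a : ℝ) (k : ℕ) (t : ℝ) : ℝ :=
  besselJ (order a) (besselZero (order a) k * Real.exp (-(t / (2 * order a)))) /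
      (√(order a) * besselJ (order a - 1) (besselZero (order a) k)) *
    Real.exp (-(t / 2))

/-- `T` is the integral operator `f ↦ ∫₀^∞ K₀(·, t) f(t) exp(-a t) dt` on `H_a`; the integral
converges absolutely at every point `s > 0`. -/
def IsCovOperator (a : ℝ) (T : Ha a →L[ℝ] Ha a) : Prop :=
  ∀ f : Ha a,
    (∀ s : ℝ, 0 < s → IntegrableOn (fun t => K0 s t * f t * Real.exp (-(a * t))) (Ioi 0)) ∧
    ∀ᵐ s ∂weightMeasure a, T f s = ∫ t in Ioi 0, K0 s t * f t * Real.exp (-(a * t))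

end ExpTest

end

/-! Write J_μ(x) = (x/2)^μ φ_μ(x²/4) with φ_μ entire. Then φ_μ' = -φ_{μ+1} and φ_{μ-1}(w) = μ φ_μ(w)
- w φ_{μ+1}(w), and by these rules G = `modeFun` and P = `modeMom` solve G' = -e^{-t} P, P' = κ
e^{-at} G with κ = c (a + 1)². The kernel K₀ is the Green's function of H ↦ -(e^t H')' with H(0) = 0
and decay at infinity. So an eigenfunction f for μ ≠ 0 gives a solution H = μ f of the same system
with κ = 1/μ, that is, c = ν²/μ.

The Wronskian of H and G is constant and tends to 0 at infinity
(`mul_besselEntire_eq_zero_of_system`). With uniqueness for the initial value problem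
(`eq_zero_of_system`), an eigenfunction forces φ_ν(c) = 0 and is a multiple of G. Since φ_ν > 0 on
(-∞, 0], this gives c = z²/4 for a positive zero z of J_ν, hence μ = (2ν/z)². The value μ = 0 is
excluded by injectivity (`eq_zero_of_covFun_ae_eq_zero`). Conversely, every zero yields an
eigenfunction through explicit antiderivatives (`integral_K0_mul_modeFun`).

Orthogonality is Lagrange's identity, and the norm comes from an energy identity
(`integral_modeFun_sq`). Positivity of that norm gives φ_{ν-1} ≠ 0 at the zeros of φ_ν, so these
zeros are simple and isolated. Sturm comparison (`not_pos_of_sturm`) makes them unbounded, and they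
can be listed in ascending order. -/

noncomputable section

namespace ExpTest

open Filter Topology

/-! ### The entire part of the Bessel series -/

/-- The entire function `φ_μ` with `J_μ(x) = (x / 2) ^ μ * φ_μ(x² / 4)`. -/
def besselEntire (μ w : ℝ) : ℝ :=
  ∑' m : ℕ, (-1) ^ m / ((m.factorial : ℝ) * Real.Gamma (m + μ + 1)) * w ^ m

/-- From m = 1 on the argument of Γ is at least 1, so Γ(x + 1) = x Γ(x) makes the values
nondecreasing. The value at m = 0 is kept apart because μ + 1 may be below 1. -/
lemma exists_le_Gamma_nat_add {μ : ℝ} (hμ : -1 < μ) :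
    ∃ c > 0, ∀ m : ℕ, c ≤ Real.Gamma (m + μ + 1) := by
  have h1 : 0 < Real.Gamma (μ + 1) := Real.Gamma_pos_of_pos (by linarith)
  have h2 : 0 < Real.Gamma (μ + 2) := Real.Gamma_pos_of_pos (by linarith)
  refine ⟨min (Real.Gamma (μ + 1)) (Real.Gamma (μ + 2)), lt_min h1 h2, fun m => ?_⟩
  rcases m with _ | m
  · simp
  · refine (min_le_right _ _).trans ?_
    induction m with
    | zero => apply le_of_eq; congr 1; push_cast; ring
    | succ m ih =>
      refine ih.trans ?_
      have hm : (0 : ℝ) ≤ m := m.cast_nonneg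
      have hpos : (1 : ℝ) ≤ ((m + 1 : ℕ) : ℝ) + μ + 1 := by push_cast; linarith
      have h := Real.Gamma_add_one (s := ((m + 1 : ℕ) : ℝ) + μ + 1) (by linarith)
      have h' : (((m + 1 + 1 : ℕ) : ℝ) + μ + 1) = ((m + 1 : ℕ) : ℝ) + μ + 1 + 1 := by
        push_cast; ring
      rw [h', h]
      exact le_mul_of_one_le_left (Real.Gamma_pos_of_pos (by linarith)).le hpos

lemma Gamma_nat_add_pos {μ : ℝ} (hμ : -1 < μ) (m : ℕ) : 0 < Real.Gamma (m + μ + 1) :=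
  Real.Gamma_pos_of_pos (by have : (0 : ℝ) ≤ m := m.cast_nonneg
                            linarith)

lemma exists_abs_besselCoeff_le {μ : ℝ} (hμ : -1 < μ) :
    ∃ C : ℝ, 0 ≤ C ∧ ∀ m : ℕ,
      |(-1) ^ m / ((m.factorial : ℝ) * Real.Gamma (m + μ + 1))| ≤ C / m.factorial := by
  obtain ⟨c, hc, h⟩ := exists_le_Gamma_nat_add hμ
  refine ⟨1 / c, by positivity, fun m => ?_⟩
  have hm : (0 : ℝ) < m.factorial := by positivity
  have hG := Gamma_nat_add_pos hμ m
  rw [abs_div, abs_pow, abs_neg, abs_one, one_pow, abs_of_pos (by positivity), div_div]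
  apply one_div_le_one_div_of_le (by positivity)
  rw [mul_comm]
  exact mul_le_mul_of_nonneg_left (h m) hm.le

lemma summable_besselEntire {μ : ℝ} (hμ : -1 < μ) (w : ℝ) :
    Summable fun m : ℕ => (-1) ^ m / ((m.factorial : ℝ) * Real.Gamma (m + μ + 1)) * w ^ m := by
  obtain ⟨C, -, h⟩ := exists_abs_besselCoeff_le hμ
  refine Summable.of_norm_bounded ((Real.summable_pow_div_factorial |w|).mul_left C) fun m => ?_
  rw [Real.norm_eq_abs, abs_mul, abs_pow]
  refine (mul_le_mul_of_nonneg_right (h m) (by positivity)).trans (le_of_eq (by ring))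

lemma besselCoeff_succ {μ : ℝ} (m : ℕ) :
    (-1) ^ (m + 1) / (((m + 1).factorial : ℝ) * Real.Gamma ((m + 1 : ℕ) + μ + 1)) * ((m + 1 : ℕ) : ℝ)
      = -((-1) ^ m / ((m.factorial : ℝ) * Real.Gamma (m + (μ + 1) + 1))) := by
  have hm : (m.factorial : ℝ) ≠ 0 := by positivity
  have hm1 : ((m : ℝ) + 1) ≠ 0 := by positivity
  have e : (((m + 1 : ℕ) : ℝ) + μ + 1) = m + (μ + 1) + 1 := by push_cast; ring
  rw [e, Nat.factorial_succ]
  push_cast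
  -- If Γ takes the value 0 here, both sides are 0 by the convention for division by zero.
  by_cases hG : Real.Gamma (m + (μ + 1) + 1) = 0
  · simp [hG]
  · field_simp
    ring

lemma hasDerivAt_besselEntire {μ : ℝ} (hμ : -1 < μ) (w : ℝ) :
    HasDerivAt (besselEntire μ) (-besselEntire (μ + 1) w) w := by
  obtain ⟨C, hC, h⟩ := exists_abs_besselCoeff_le hμ
  set R := |w| + 1
  have hR : 0 ≤ R := by positivity
  have hu : Summable fun n : ℕ => C / n.factorial * (n * R ^ (n - 1)) := by
    rw [← summable_nat_add_iff 1]
    refine ((Real.summable_pow_div_factorial R).mul_left C).congr fun n => ?_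
    rw [Nat.factorial_succ]
    have hm1 : ((n : ℝ) + 1) ≠ 0 := by positivity
    push_cast
    field_simp
  have key := hasDerivAt_tsum_of_isPreconnected (𝕜 := ℝ) (F := ℝ)
    (g := fun (n : ℕ) w => (-1) ^ n / ((n.factorial : ℝ) * Real.Gamma (n + μ + 1)) * w ^ n)
    (g' := fun (n : ℕ) w => (-1) ^ n / ((n.factorial : ℝ) * Real.Gamma (n + μ + 1)) * (n * w ^ (n - 1)))
    (t := Metric.ball 0 R) (y₀ := 0) (y := w) hu Metric.isOpen_ball
    (convex_ball 0 R).isPreconnected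
    (fun n y _ => (hasDerivAt_pow n y).const_mul _)
    (fun n y hy => by
      rw [Real.norm_eq_abs, abs_mul, abs_mul, Nat.abs_cast, abs_pow]
      have hy' : |y| ≤ R := by simpa using (mem_ball_zero_iff.mp hy).le
      gcongr
      exact h n)
    (by simp; positivity) (summable_besselEntire hμ 0) (by simp [R])
  refine key.congr_deriv ?_
  have hs : Summable fun n : ℕ =>
      (-1) ^ n / ((n.factorial : ℝ) * Real.Gamma (n + μ + 1)) * (n * w ^ (n - 1)) := by
    refine Summable.of_norm_bounded hu fun n => ?_
    rw [Real.norm_eq_abs, abs_mul, abs_mul, Nat.abs_cast, abs_pow]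
    have hy' : |w| ≤ R := by simp [R]
    gcongr
    exact h n
  rw [hs.tsum_eq_zero_add, besselEntire, ← tsum_neg]
  simp only [Nat.cast_zero, zero_mul, mul_zero, zero_add]
  refine tsum_congr fun n => ?_
  rw [← mul_assoc, besselCoeff_succ]
  simp

lemma continuous_besselEntire {μ : ℝ} (hμ : -1 < μ) : Continuous (besselEntire μ) :=
  continuous_iff_continuousAt.2 fun w => (hasDerivAt_besselEntire hμ w).continuousAt

/-- The recurrence J_{μ-1} + J_{μ+1} = (2μ/x) J_μ, compared coefficient by coefficient after
splitting off the constant terms. -/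
lemma besselEntire_sub_one {μ : ℝ} (hμ : 0 < μ) (w : ℝ) :
    besselEntire (μ - 1) w = μ * besselEntire μ w - w * besselEntire (μ + 1) w := by
  have h1 := summable_besselEntire (μ := μ) (by linarith) w
  have h2 := summable_besselEntire (μ := μ + 1) (by linarith) w
  have h0 := summable_besselEntire (μ := μ - 1) (by linarith) w
  have hp : 0 < Real.Gamma μ := Real.Gamma_pos_of_pos hμ
  unfold besselEntire
  rw [h0.tsum_eq_zero_add, h1.tsum_eq_zero_add, mul_add, add_sub_assoc, ← tsum_mul_left,
    ← tsum_mul_left, ← Summable.tsum_sub (((summable_nat_add_iff 1).2 h1).mul_left μ)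
      (h2.mul_left w)]
  congr 1
  · simp only [Nat.cast_zero, zero_add, sub_add_cancel]
    rw [Real.Gamma_add_one hμ.ne']
    simp
    field_simp
  · refine tsum_congr fun m => ?_
    have e1 : (((m + 1 : ℕ) : ℝ) + (μ - 1) + 1) = m + μ + 1 := by push_cast; ring
    have e2 : (((m + 1 : ℕ) : ℝ) + μ + 1) = m + μ + 1 + 1 := by push_cast; ring
    have e3 : ((m : ℝ) + (μ + 1) + 1) = m + μ + 1 + 1 := by ring
    have hm : (0 : ℝ) ≤ m := m.cast_nonneg
    have hs : (m : ℝ) + μ + 1 ≠ 0 := by positivity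
    have hG : Real.Gamma (m + μ + 1) ≠ 0 := (Real.Gamma_pos_of_pos (by positivity)).ne'
    have hf : (m.factorial : ℝ) ≠ 0 := by positivity
    have hm1 : ((m : ℝ) + 1) ≠ 0 := by positivity
    rw [e1, e2, e3, Real.Gamma_add_one hs, Nat.factorial_succ]
    push_cast
    field_simp
    ring

/-- For w ≤ 0 the alternating signs disappear. This later rules out negative eigenvalues. -/
lemma besselEntire_pos_of_nonpos {μ : ℝ} (hμ : -1 < μ) {w : ℝ} (hw : w ≤ 0) :
    0 < besselEntire μ w := by
  refine (summable_besselEntire hμ w).tsum_pos (fun m => ?_) 0 ?_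
  · have := Gamma_nat_add_pos hμ m
    rw [div_mul_eq_mul_div, ← mul_pow]
    have : 0 ≤ -1 * w := by linarith
    positivity
  · have := Gamma_nat_add_pos hμ 0
    simp only [pow_zero, mul_one]
    positivity

lemma besselJ_eq {x : ℝ} (hx : 0 < x) (μ : ℝ) :
    besselJ μ x = (x / 2) ^ μ * besselEntire μ (x ^ 2 / 4) := by
  rw [besselJ, besselEntire, ← tsum_mul_left]
  refine tsum_congr fun m => ?_
  have e : (x / 2) ^ (2 * (m : ℝ) + μ) = (x ^ 2 / 4) ^ m * (x / 2) ^ μ := by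
    rw [Real.rpow_add (by positivity), show (2 * (m : ℝ)) = ((2 * m : ℕ) : ℝ) by push_cast; ring,
      Real.rpow_natCast, pow_mul]
    congr 2
    ring
  rw [e]
  ring

lemma besselJ_eq_zero_iff {x : ℝ} (hx : 0 < x) (μ : ℝ) :
    besselJ μ x = 0 ↔ besselEntire μ (x ^ 2 / 4) = 0 := by
  rw [besselJ_eq hx, mul_eq_zero, or_iff_right (by positivity)]

/-! ### Orders 1/2 and -1/2: sine and cosine -/

lemma besselEntire_half {x : ℝ} :
    besselEntire (1 / 2) (x ^ 2 / 4) * x = 2 / √Real.pi * Real.sin x := by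
  rw [besselEntire, ← tsum_mul_right, ← (Real.hasSum_sin x).tsum_eq, ← tsum_mul_left]
  refine tsum_congr fun m => ?_
  -- Legendre's duplication formula turns m! Γ(m + 3/2) into (2m + 1)! up to a power of 2 and √π.
  have h := Real.Gamma_mul_Gamma_add_half (m + 1)
  have e1 : (2 * ((m : ℝ) + 1)) = ((2 * m + 1 : ℕ) : ℝ) + 1 := by push_cast; ring
  have e2 : (2 : ℝ) ^ (1 - (((2 * m + 1 : ℕ) : ℝ) + 1)) = (2 ^ (2 * m + 1))⁻¹ := by
    rw [show (1 - (((2 * m + 1 : ℕ) : ℝ) + 1)) = -((2 * m + 1 : ℕ) : ℝ) by ring,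
      Real.rpow_neg (by norm_num), Real.rpow_natCast]
  rw [e1, e2, Real.Gamma_nat_eq_factorial, Real.Gamma_nat_eq_factorial,
    show (m : ℝ) + 1 + 1 / 2 = m + 1 / 2 + 1 by ring] at h
  have hp : √Real.pi ≠ 0 := by positivity
  have hf : ((2 * m + 1).factorial : ℝ) ≠ 0 := by positivity
  rw [h, show x ^ 2 / 4 = (x / 2) ^ 2 by ring, ← pow_mul, div_pow]
  field_simp
  ring

lemma besselEntire_neg_half {x : ℝ} :
    besselEntire (1 / 2 - 1) (x ^ 2 / 4) = 1 / √Real.pi * Real.cos x := by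
  rw [besselEntire, ← (Real.hasSum_cos x).tsum_eq, ← tsum_mul_left]
  refine tsum_congr fun m => ?_
  have h := Real.Gamma_mul_Gamma_add_half (m + 1 / 2)
  have e1 : (2 * ((m : ℝ) + 1 / 2)) = ((2 * m : ℕ) : ℝ) + 1 := by push_cast; ring
  have e2 : (2 : ℝ) ^ (1 - (((2 * m : ℕ) : ℝ) + 1)) = (2 ^ (2 * m))⁻¹ := by
    rw [show (1 - (((2 * m : ℕ) : ℝ) + 1)) = -((2 * m : ℕ) : ℝ) by ring,
      Real.rpow_neg (by norm_num), Real.rpow_natCast]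
  rw [e1, e2, Real.Gamma_nat_eq_factorial, show (m : ℝ) + 1 / 2 + 1 / 2 = m + 1 by ring,
    Real.Gamma_nat_eq_factorial, mul_comm] at h
  have hp : √Real.pi ≠ 0 := by positivity
  have hf : ((2 * m).factorial : ℝ) ≠ 0 := by positivity
  rw [show (m : ℝ) + (1 / 2 - 1) + 1 = m + 1 / 2 by ring, h,
    show x ^ 2 / 4 = (x / 2) ^ 2 by ring, ← pow_mul, div_pow]
  field_simp

/-! ### The Sturm–Liouville system of the modes -/

/-- The solution `e^{-t} φ_ν(c e^{-(a+1)t})` of the Sturm–Liouville system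
`G' = -e^{-t} P`, `P' = c (a + 1)² e^{-at} G` which vanishes at infinity. -/
def modeFun (a c t : ℝ) : ℝ :=
  Real.exp (-t) * besselEntire (order a) (c * Real.exp (-((a + 1) * t)))

/-- The conjugate variable `P` of `modeFun`. -/
def modeMom (a c t : ℝ) : ℝ :=
  (a + 1) * besselEntire (order a - 1) (c * Real.exp (-((a + 1) * t)))

lemma order_pos {a : ℝ} (ha : -1 < a) : 0 < order a := inv_pos.2 (by linarith)

lemma order_mul {a : ℝ} (ha : -1 < a) : (a + 1) * order a = 1 :=
  mul_inv_cancel₀ (by linarith)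

lemma hasDerivAt_exp_neg_mul (b t : ℝ) :
    HasDerivAt (fun t => Real.exp (-(b * t))) (-(b * Real.exp (-(b * t)))) t := by
  have := (((hasDerivAt_id t).const_mul b).neg).exp
  exact this.congr_deriv (by simp; ring)

lemma hasDerivAt_exp_neg' (t : ℝ) :
    HasDerivAt (fun t => Real.exp (-t)) (-Real.exp (-t)) t := by
  simpa using hasDerivAt_exp_neg_mul 1 t

lemma hasDerivAt_modeFun {a : ℝ} (ha : -1 < a) (c t : ℝ) :
    HasDerivAt (modeFun a c) (-(Real.exp (-t) * modeMom a c t)) t := by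
  have hν := order_pos ha
  have h1 := (hasDerivAt_besselEntire (μ := order a) (by linarith)
    (c * Real.exp (-((a + 1) * t)))).comp t ((hasDerivAt_exp_neg_mul (a + 1) t).const_mul c)
  refine ((hasDerivAt_exp_neg' t).mul h1).congr_deriv ?_
  rw [modeMom, besselEntire_sub_one hν]
  simp only [Function.comp]
  linear_combination (-Real.exp (-t) *
    besselEntire (order a) (c * Real.exp (-((a + 1) * t)))) * (- order_mul ha)

lemma hasDerivAt_modeMom {a : ℝ} (ha : -1 < a) (c t : ℝ) :
    HasDerivAt (modeMom a c) (c * (a + 1) ^ 2 * (Real.exp (-(a * t)) * modeFun a c t)) t := by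
  have hν := order_pos ha
  have h1 := (hasDerivAt_besselEntire (μ := order a - 1) (by linarith)
    (c * Real.exp (-((a + 1) * t)))).comp t ((hasDerivAt_exp_neg_mul (a + 1) t).const_mul c)
  refine (h1.const_mul (a + 1)).congr_deriv ?_
  have e : Real.exp (-((a + 1) * t)) = Real.exp (-(a * t)) * Real.exp (-t) := by
    rw [← Real.exp_add]; ring_nf
  rw [modeFun, sub_add_cancel]
  nth_rewrite 2 [e]
  ring

lemma modeFun_zero (a c : ℝ) : modeFun a c 0 = besselEntire (order a) c := by simp [modeFun]

lemma modeMom_zero (a c : ℝ) : modeMom a c 0 = (a + 1) * besselEntire (order a - 1) c := by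
  simp [modeMom]

lemma continuous_modeFun {a : ℝ} (ha : -1 < a) (c : ℝ) : Continuous (modeFun a c) :=
  continuous_iff_continuousAt.2 fun t => (hasDerivAt_modeFun ha c t).continuousAt

lemma tendsto_exp_neg_mul {b : ℝ} (hb : 0 < b) :
    Tendsto (fun t => Real.exp (-(b * t))) atTop (𝓝 0) :=
  Real.tendsto_exp_neg_atTop_nhds_zero.comp (tendsto_id.const_mul_atTop hb)

lemma tendsto_besselEntire_exp {a : ℝ} (ha : -1 < a) {μ : ℝ} (hμ : -1 < μ) (c : ℝ) :
    Tendsto (fun t => besselEntire μ (c * Real.exp (-((a + 1) * t)))) atTop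
      (𝓝 (besselEntire μ 0)) := by
  refine ((continuous_besselEntire hμ).tendsto 0).comp ?_
  simpa using (tendsto_exp_neg_mul (b := a + 1) (by linarith)).const_mul c

lemma tendsto_modeMom {a : ℝ} (ha : -1 < a) (c : ℝ) :
    Tendsto (modeMom a c) atTop (𝓝 ((a + 1) * besselEntire (order a - 1) 0)) :=
  (tendsto_besselEntire_exp ha (by have := order_pos ha; linarith) c).const_mul _

lemma tendsto_exp_mul_modeFun {a : ℝ} (ha : -1 < a) (c : ℝ) :
    Tendsto (fun t => Real.exp t * modeFun a c t) atTop (𝓝 (besselEntire (order a) 0)) := by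
  refine (tendsto_besselEntire_exp ha (by have := order_pos ha; linarith) c).congr fun t => ?_
  rw [modeFun, ← mul_assoc, ← Real.exp_add]
  simp

lemma tendsto_modeFun {a : ℝ} (ha : -1 < a) (c : ℝ) :
    Tendsto (modeFun a c) atTop (𝓝 0) := by
  have h := Real.tendsto_exp_neg_atTop_nhds_zero.mul
    (tendsto_besselEntire_exp ha (μ := order a) (by have := order_pos ha; linarith) c)
  rw [zero_mul] at h
  exact h

lemma exists_abs_modeFun_le {a : ℝ} (ha : -1 < a) (c : ℝ) :
    ∃ C, 0 ≤ C ∧ ∀ t, 0 ≤ t → |modeFun a c t| ≤ C * Real.exp (-t) := by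
  have hν := order_pos ha
  obtain ⟨C, hC⟩ := (isCompact_closedBall (0 : ℝ) |c|).exists_bound_of_continuousOn
    (continuous_besselEntire (μ := order a) (by linarith)).continuousOn
  refine ⟨C, (norm_nonneg _).trans (hC 0 (by simp)), fun t ht => ?_⟩
  rw [modeFun, abs_mul, Real.abs_exp, mul_comm]
  gcongr
  refine hC _ ?_
  rw [mem_closedBall_zero_iff, Real.norm_eq_abs, abs_mul, Real.abs_exp]
  refine mul_le_of_le_one_right (abs_nonneg _) (Real.exp_le_one_iff.2 ?_)
  have : 0 ≤ (a + 1) * t := mul_nonneg (by linarith) ht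
  linarith

lemma integrableOn_exp_neg_mul {b : ℝ} (hb : 0 < b) (x : ℝ) :
    IntegrableOn (fun t => Real.exp (-(b * t))) (Ioi x) := by
  simpa [neg_mul] using exp_neg_integrableOn_Ioi x hb

/-- A continuous function bounded by `C e^{-t}` on `[0, ∞)` is integrable against `e^{-at} dt`. -/
lemma integrableOn_of_abs_le_exp {a : ℝ} (ha : -1 < a) {f : ℝ → ℝ} (hf : Continuous f) {C : ℝ}
    (h : ∀ t, 0 ≤ t → |f t| ≤ C * Real.exp (-t)) :
    IntegrableOn (fun t => f t * Real.exp (-(a * t))) (Ioi 0) := by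
  refine Integrable.mono' ((integrableOn_exp_neg_mul (b := a + 1) (by linarith) 0).const_mul C)
    (by fun_prop) ?_
  filter_upwards [ae_restrict_mem measurableSet_Ioi] with t ht
  rw [Real.norm_eq_abs, abs_mul, Real.abs_exp]
  refine (mul_le_mul_of_nonneg_right (h t (le_of_lt ht)) (Real.exp_pos _).le).trans (le_of_eq ?_)
  rw [mul_assoc, ← Real.exp_add]
  ring_nf

lemma integrableOn_modeFun_mul {a : ℝ} (ha : -1 < a) (c d : ℝ) :
    IntegrableOn (fun t => modeFun a c t * modeFun a d t * Real.exp (-(a * t))) (Ioi 0) := by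
  obtain ⟨C, hC, h1⟩ := exists_abs_modeFun_le ha c
  obtain ⟨D, hD, h2⟩ := exists_abs_modeFun_le ha d
  refine integrableOn_of_abs_le_exp ha ((continuous_modeFun ha c).mul (continuous_modeFun ha d))
    (C := C * D) fun t ht => ?_
  have h3 : |modeFun a d t| ≤ D :=
    (h2 t ht).trans (mul_le_of_le_one_right hD (Real.exp_le_one_iff.2 (by linarith)))
  rw [abs_mul]
  calc _ ≤ (C * Real.exp (-t)) * D :=
        mul_le_mul (h1 t ht) h3 (abs_nonneg _) (by positivity)
    _ = _ := by ring

/-! ### Norms and orthogonality of the modes -/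

lemma integral_modeFun_sq {a : ℝ} (ha : -1 < a) {c : ℝ} (hc : c ≠ 0)
    (h0 : besselEntire (order a) c = 0) :
    ∫ t in Ioi 0, modeFun a c t * modeFun a c t * Real.exp (-(a * t)) =
      order a / c * besselEntire (order a - 1) c ^ 2 := by
  have hG := tendsto_modeFun ha c
  have hP := tendsto_modeMom ha c
  -- Energy identity: the cross terms cancel and only -(a + 1) κ e^{-at} G² survives. At 0, where G
  -- vanishes, the energy is P(0)², and at infinity it tends to 0.
  have hd : ∀ t, HasDerivAt (fun t => Real.exp (-t) * modeMom a c t ^ 2 +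
      c * (a + 1) ^ 2 * (Real.exp (-(a * t)) * modeFun a c t ^ 2) - modeFun a c t * modeMom a c t)
      (-(c * (a + 1) ^ 3) * (modeFun a c t * modeFun a c t * Real.exp (-(a * t)))) t := by
    intro t
    have dG := hasDerivAt_modeFun ha c t
    have dP := hasDerivAt_modeMom ha c t
    refine ((((hasDerivAt_exp_neg' t).mul (dP.pow 2)).add
      (((hasDerivAt_exp_neg_mul a t).mul (dG.pow 2)).const_mul _)).sub
      (dG.mul dP)).congr_deriv ?_
    simp only [Pi.pow_apply]
    push_cast
    ring
  -- For a < 0 the weight grows, so it is absorbed as e^{-at} G² = e^{-(a+1)t} (e^t G) G.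
  have hw : Tendsto (fun t => Real.exp (-(a * t)) * modeFun a c t ^ 2) atTop (𝓝 0) := by
    have h := ((tendsto_exp_neg_mul (b := a + 1) (by linarith)).mul
      (tendsto_exp_mul_modeFun ha c)).mul hG
    rw [mul_zero] at h
    refine h.congr fun t => ?_
    rw [← mul_assoc, ← Real.exp_add]
    ring_nf
  have hlim := ((Real.tendsto_exp_neg_atTop_nhds_zero.mul (hP.pow 2)).add
    (hw.const_mul (c * (a + 1) ^ 2))).sub (hG.mul hP)
  have key := integral_Ioi_of_hasDerivAt_of_tendsto (a := 0)
    (hd 0).continuousAt.continuousWithinAt (fun t _ => hd t)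
    ((integrableOn_modeFun_mul ha c c).const_mul _) hlim
  rw [integral_const_mul, modeFun_zero, h0, modeMom_zero] at key
  simp only [neg_zero, Real.exp_zero] at key
  have h1 : c * (a + 1) ^ 3 ≠ 0 := mul_ne_zero hc (pow_ne_zero 3 (by linarith))
  apply mul_left_cancel₀ h1
  have h2 : c * (a + 1) ^ 3 * (order a / c * besselEntire (order a - 1) c ^ 2) =
      ((a + 1) * order a) * ((a + 1) ^ 2 * besselEntire (order a - 1) c ^ 2) := by
    field_simp
  rw [h2, order_mul ha]
  linear_combination -key

/-- Otherwise the norm formula gives G = 0 on (0, ∞), while e^t G tends to φ_ν(0) > 0. In effect,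
the zeros of φ_ν are simple. -/
lemma besselEntire_sub_one_ne_zero {a : ℝ} (ha : -1 < a) {c : ℝ}
    (h0 : besselEntire (order a) c = 0) : besselEntire (order a - 1) c ≠ 0 := by
  have hν := order_pos ha
  intro h
  have hc : c ≠ 0 := by
    rintro rfl
    exact (besselEntire_pos_of_nonpos (μ := order a) (by linarith) le_rfl).ne' h0
  have h1 := integral_modeFun_sq ha hc h0
  rw [h, zero_pow two_ne_zero, mul_zero,
    setIntegral_eq_zero_iff_of_nonneg_ae
      (ae_of_all _ fun t => mul_nonneg (mul_self_nonneg _) (Real.exp_pos _).le)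
      (integrableOn_modeFun_mul ha c c)] at h1
  have h2 : ∀ t ∈ Ioi (0 : ℝ), modeFun a c t * modeFun a c t * Real.exp (-(a * t)) = 0 := by
    have hcont : Continuous fun t => modeFun a c t * modeFun a c t * Real.exp (-(a * t)) := by
      have := continuous_modeFun ha c
      fun_prop
    exact MeasureTheory.Measure.eqOn_open_of_ae_eq h1 isOpen_Ioi hcont.continuousOn
      continuousOn_const
  have h3 : ∀ t ∈ Ioi (0 : ℝ), Real.exp t * modeFun a c t = 0 := fun t ht => by
    have := h2 t ht
    simp only [mul_eq_zero, (Real.exp_pos _).ne', or_false, or_self] at this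
    rw [this, mul_zero]
  have h4 : Tendsto (fun t => Real.exp t * modeFun a c t) atTop (𝓝 0) :=
    tendsto_const_nhds.congr' (by
      filter_upwards [eventually_gt_atTop 0] with t ht using (h3 t ht).symm)
  exact (besselEntire_pos_of_nonpos (μ := order a) (by linarith) le_rfl).ne'
    (tendsto_nhds_unique (tendsto_exp_mul_modeFun ha c) h4)

/-- Lagrange's identity: the Wronskian has derivative (c - d)(a + 1)² times the integrand and
vanishes at both ends. -/
lemma integral_modeFun_mul_eq_zero {a : ℝ} (ha : -1 < a) {c d : ℝ} (hcd : c ≠ d)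
    (hc : besselEntire (order a) c = 0) (hd : besselEntire (order a) d = 0) :
    ∫ t in Ioi 0, modeFun a c t * modeFun a d t * Real.exp (-(a * t)) = 0 := by
  have hder : ∀ t, HasDerivAt
      (fun t => modeMom a c t * modeFun a d t - modeFun a c t * modeMom a d t)
      ((c - d) * (a + 1) ^ 2 * (modeFun a c t * modeFun a d t * Real.exp (-(a * t)))) t := by
    intro t
    refine (((hasDerivAt_modeMom ha c t).mul (hasDerivAt_modeFun ha d t)).sub
      ((hasDerivAt_modeFun ha c t).mul (hasDerivAt_modeMom ha d t))).congr_deriv ?_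
    ring
  have hlim := ((tendsto_modeMom ha c).mul (tendsto_modeFun ha d)).sub
    ((tendsto_modeFun ha c).mul (tendsto_modeMom ha d))
  have key := integral_Ioi_of_hasDerivAt_of_tendsto (a := 0)
    (hder 0).continuousAt.continuousWithinAt (fun t _ => hder t)
    ((integrableOn_modeFun_mul ha c d).const_mul _) hlim
  rw [integral_const_mul, modeFun_zero, modeFun_zero, hc, hd] at key
  have h1 : (a + 1) ^ 2 ≠ 0 := pow_ne_zero 2 (by linarith)
  have h2 := sub_ne_zero.2 hcd
  simpa [h1, h2] using key

/-! ### The kernel as a Green's function -/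

lemma K0_of_le {s t : ℝ} (h : t ≤ s) : K0 s t = Real.exp (-s) * (1 - Real.exp (-t)) := by
  rw [K0, max_eq_left h, neg_add, Real.exp_add]; ring

lemma K0_of_ge {s t : ℝ} (h : s ≤ t) : K0 s t = (1 - Real.exp (-s)) * Real.exp (-t) := by
  rw [K0, max_eq_right h, neg_add, Real.exp_add]; ring

/-- The integral against `K₀(s, ·)` split at the diagonal. -/
lemma integral_K0_mul {f : ℝ → ℝ} {s : ℝ} (hs : 0 ≤ s)
    (h1 : IntegrableOn (fun t => (1 - Real.exp (-t)) * f t) (Ioc 0 s))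
    (h2 : IntegrableOn (fun t => Real.exp (-t) * f t) (Ioi s)) :
    ∫ t in Ioi 0, K0 s t * f t =
      Real.exp (-s) * (∫ t in Ioc 0 s, (1 - Real.exp (-t)) * f t) +
        (1 - Real.exp (-s)) * ∫ t in Ioi s, Real.exp (-t) * f t := by
  have e1 : EqOn (fun t => Real.exp (-s) * ((1 - Real.exp (-t)) * f t))
      (fun t => K0 s t * f t) (Ioc 0 s) := fun t ht => by
    simp only [K0_of_le ht.2]; ring
  have e2 : EqOn (fun t => (1 - Real.exp (-s)) * (Real.exp (-t) * f t))
      (fun t => K0 s t * f t) (Ioi s) := fun t ht => by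
    simp only [K0_of_ge (le_of_lt ht)]; ring
  rw [← Ioc_union_Ioi_eq_Ioi hs, setIntegral_union (Ioc_disjoint_Ioi le_rfl) measurableSet_Ioi
    (IntegrableOn.congr_fun (h1.const_mul _) e1 measurableSet_Ioc)
    (IntegrableOn.congr_fun (h2.const_mul _) e2 measurableSet_Ioi),
    ← setIntegral_congr_fun measurableSet_Ioc e1, ← setIntegral_congr_fun measurableSet_Ioi e2,
    integral_const_mul, integral_const_mul]

/-- The Fredholm equation for `modeFun`. -/
lemma integral_K0_mul_modeFun {a : ℝ} (ha : -1 < a) {c : ℝ} (hc : c ≠ 0)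
    (h0 : besselEntire (order a) c = 0) {s : ℝ} (hs : 0 ≤ s) :
    ∫ t in Ioi 0, K0 s t * (modeFun a c t * Real.exp (-(a * t))) =
      order a ^ 2 / c * modeFun a c s := by
  have hcont := continuous_modeFun ha c
  set κ := c * (a + 1) ^ 2 with hκ
  have hκ0 : κ ≠ 0 := mul_ne_zero hc (pow_ne_zero 2 (by linarith))
  -- The system supplies explicit antiderivatives on both sides of the diagonal. In the combination
  -- the P terms cancel, G(0) = 0, and κ⁻¹ G(s) remains.
  have d1 : ∀ t, HasDerivAt (fun t => κ⁻¹ * ((1 - Real.exp (-t)) * modeMom a c t + modeFun a c t))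
      ((1 - Real.exp (-t)) * (modeFun a c t * Real.exp (-(a * t)))) t := by
    intro t
    refine (((((hasDerivAt_exp_neg' t).const_sub 1).mul (hasDerivAt_modeMom ha c t)).add
      (hasDerivAt_modeFun ha c t)).const_mul κ⁻¹).congr_deriv ?_
    rw [← hκ]
    field_simp
    ring
  have d2 : ∀ t, HasDerivAt (fun t => κ⁻¹ * (Real.exp (-t) * modeMom a c t - modeFun a c t))
      (Real.exp (-t) * (modeFun a c t * Real.exp (-(a * t)))) t := by
    intro t
    refine ((((hasDerivAt_exp_neg' t).mul (hasDerivAt_modeMom ha c t)).sub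
      (hasDerivAt_modeFun ha c t)).const_mul κ⁻¹).congr_deriv ?_
    rw [← hκ]
    field_simp
    ring
  obtain ⟨C, hC, hb⟩ := exists_abs_modeFun_le ha c
  have i2 : IntegrableOn (fun t => Real.exp (-t) * (modeFun a c t * Real.exp (-(a * t))))
      (Ioi s) := by
    have := integrableOn_of_abs_le_exp ha (f := fun t => Real.exp (-t) * modeFun a c t)
      (by fun_prop) (C := C) fun t ht => by
        rw [abs_mul, Real.abs_exp]
        exact (mul_le_of_le_one_left (abs_nonneg _)
          (Real.exp_le_one_iff.2 (by linarith))).trans (hb t ht)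
    simpa only [mul_assoc] using this.mono_set (Ioi_subset_Ioi hs)
  have c1 : Continuous fun t => (1 - Real.exp (-t)) * (modeFun a c t * Real.exp (-(a * t))) := by
    fun_prop
  have I1 := intervalIntegral.integral_eq_sub_of_hasDerivAt (a := 0) (b := s) (fun t _ => d1 t)
    (c1.intervalIntegrable _ _)
  have hlim := ((Real.tendsto_exp_neg_atTop_nhds_zero.mul (tendsto_modeMom ha c)).sub
    (tendsto_modeFun ha c)).const_mul κ⁻¹
  have I2 := integral_Ioi_of_hasDerivAt_of_tendsto (a := s)
    (d2 s).continuousAt.continuousWithinAt (fun t _ => d2 t) i2 hlim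
  rw [intervalIntegral.integral_of_le hs] at I1
  rw [integral_K0_mul hs c1.integrableOn_Ioc i2, I1, I2, modeFun_zero, h0]
  have : order a ^ 2 / c = κ⁻¹ := by
    rw [hκ, order, mul_inv, inv_pow]; ring
  rw [this]
  simp only [neg_zero, Real.exp_zero]
  ring

/-! ### Infinitely many zeros by Sturm comparison -/

/-- Sturm comparison with `sin ((x - α) / 2)`: a solution of `u'' = -q u` with `q ≥ 1 / 4` is not
positive on an interval of length `2π`. -/
lemma not_pos_of_sturm {u u' q : ℝ → ℝ} {α : ℝ}
    (hu : ∀ x ∈ Icc α (α + 2 * Real.pi), HasDerivAt u (u' x) x)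
    (hu' : ∀ x ∈ Icc α (α + 2 * Real.pi), HasDerivAt u' (-(q x * u x)) x)
    (hq : ∀ x ∈ Icc α (α + 2 * Real.pi), 1 / 4 ≤ q x)
    (hpos : ∀ x ∈ Icc α (α + 2 * Real.pi), 0 < u x) : False := by
  have hpi := Real.pi_pos
  have hder : ∀ x ∈ Icc α (α + 2 * Real.pi), HasDerivAt
      (fun x => u x * (Real.cos ((x - α) / 2) / 2) - u' x * Real.sin ((x - α) / 2))
      ((q x - 1 / 4) * u x * Real.sin ((x - α) / 2)) x := by
    intro x hx
    have h1 : HasDerivAt (fun x => (x - α) / 2) (1 / 2) x :=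
      ((hasDerivAt_id x).sub_const α).div_const 2
    refine (((hu x hx).mul (h1.cos.div_const 2)).sub ((hu' x hx).mul h1.sin)).congr_deriv ?_
    ring
  -- The Wronskian with the sine increases, yet it is u(α)/2 > 0 on the left and -u(α + 2π)/2 < 0 on
  -- the right.
  have hmono : MonotoneOn
      (fun x => u x * (Real.cos ((x - α) / 2) / 2) - u' x * Real.sin ((x - α) / 2))
      (Icc α (α + 2 * Real.pi)) := by
    refine monotoneOn_of_deriv_nonneg (convex_Icc _ _)
      (fun x hx => (hder x hx).continuousAt.continuousWithinAt)
      (fun x hx => (hder x (interior_subset hx)).differentiableAt.differentiableWithinAt)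
      fun x hx => ?_
    have hx' := interior_subset hx
    rw [(hder x hx').deriv]
    have := hq x hx'
    refine mul_nonneg (mul_nonneg (by linarith) (hpos x hx').le)
      (Real.sin_nonneg_of_nonneg_of_le_pi (by linarith [hx'.1]) (by linarith [hx'.2]))
  have hl : α ∈ Icc α (α + 2 * Real.pi) := ⟨le_rfl, by linarith⟩
  have hr : α + 2 * Real.pi ∈ Icc α (α + 2 * Real.pi) := ⟨by linarith, le_rfl⟩
  have h := hmono hl hr (by linarith)
  have e : (α + 2 * Real.pi - α) / 2 = Real.pi := by ring
  simp only [e, sub_self, zero_div, Real.cos_zero, Real.sin_zero, Real.cos_pi, Real.sin_pi] at h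
  have h1 := hpos _ hl
  have h2 := hpos _ hr
  linarith

lemma hasDerivAt_besselEntire_sq {μ : ℝ} (hμ : -1 < μ) (x : ℝ) :
    HasDerivAt (fun x => besselEntire μ (x ^ 2 / 4))
      (-(x / 2 * besselEntire (μ + 1) (x ^ 2 / 4))) x := by
  have h := (hasDerivAt_besselEntire hμ (x ^ 2 / 4)).comp x ((hasDerivAt_pow 2 x).div_const 4)
  refine h.congr_deriv ?_
  push_cast
  ring

/-- The derivative of `x ^ (ν + 1 / 2) φ_ν(x² / 4)`. -/
lemma hasDerivAt_rpow_mul_besselEntire {ν : ℝ} (hν : 0 < ν) {x : ℝ} (hx : 0 < x) :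
    HasDerivAt (fun x => x ^ (ν + 1 / 2) * besselEntire ν (x ^ 2 / 4))
      (x ^ (ν - 1 / 2) * (2 * besselEntire (ν - 1) (x ^ 2 / 4) +
        (1 / 2 - ν) * besselEntire ν (x ^ 2 / 4))) x := by
  refine ((Real.hasDerivAt_rpow_const (p := ν + 1 / 2) (Or.inl hx.ne')).mul
    (hasDerivAt_besselEntire_sq (μ := ν) (by linarith) x)).congr_deriv ?_
  have e1 : x ^ (ν + 1 / 2) = x * x ^ (ν - 1 / 2) := by
    rw [show ν + 1 / 2 = 1 + (ν - 1 / 2) by ring, Real.rpow_add hx, Real.rpow_one]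
  rw [e1, show ν + 1 / 2 - 1 = ν - 1 / 2 by ring, besselEntire_sub_one hν]
  ring

/-- `u(x) = x ^ (ν + 1 / 2) φ_ν(x² / 4)` solves `u'' = -(1 - (ν² - 1 / 4) / x²) u`. -/
lemma hasDerivAt_deriv_rpow_mul_besselEntire {ν : ℝ} (hν : 0 < ν) {x : ℝ} (hx : 0 < x) :
    HasDerivAt (fun x => x ^ (ν - 1 / 2) * (2 * besselEntire (ν - 1) (x ^ 2 / 4) +
        (1 / 2 - ν) * besselEntire ν (x ^ 2 / 4)))
      (-((1 - (ν ^ 2 - 1 / 4) / x ^ 2) * (x ^ (ν + 1 / 2) * besselEntire ν (x ^ 2 / 4)))) x := by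
  refine ((Real.hasDerivAt_rpow_const (p := ν - 1 / 2) (Or.inl hx.ne')).mul
    (((hasDerivAt_besselEntire_sq (μ := ν - 1) (by linarith) x).const_mul 2).add
      ((hasDerivAt_besselEntire_sq (μ := ν) (by linarith) x).const_mul (1 / 2 - ν)))).congr_deriv ?_
  have e1 : x ^ (ν + 1 / 2) = x ^ 2 * x ^ (ν - 1 / 2 - 1) := by
    rw [show ν + 1 / 2 = (2 : ℕ) + (ν - 1 / 2 - 1) by push_cast; ring, Real.rpow_add hx,
      Real.rpow_natCast]
  have e2 : x ^ (ν - 1 / 2) = x * x ^ (ν - 1 / 2 - 1) := by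
    nth_rewrite 1 [show ν - 1 / 2 = 1 + (ν - 1 / 2 - 1) by ring]
    rw [Real.rpow_add hx, Real.rpow_one]
  simp only [Pi.add_apply]
  rw [e1, e2, sub_add_cancel, besselEntire_sub_one hν]
  generalize x ^ (ν - 1 / 2 - 1) = r
  field_simp
  ring

lemma exists_zero_besselEntire {ν : ℝ} (hν : 0 < ν) {α : ℝ} (hα : 2 * ν ≤ α) :
    ∃ x ∈ Icc α (α + 2 * Real.pi), besselEntire ν (x ^ 2 / 4) = 0 := by
  by_contra! hne
  have hx0 : ∀ x ∈ Icc α (α + 2 * Real.pi), 0 < x := fun x hx => by linarith [hx.1]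
  -- From x ≥ 2ν one gets ν² ≤ x²/4, which is more than enough for the coefficient to stay above
  -- 1/4.
  have hq : ∀ x ∈ Icc α (α + 2 * Real.pi), 1 / 4 ≤ 1 - (ν ^ 2 - 1 / 4) / x ^ 2 := by
    intro x hx
    have hx' := hx0 x hx
    have h2 : (2 * ν) ^ 2 ≤ x ^ 2 := by
      have := hx.1
      gcongr
      linarith
    rw [le_sub_comm, div_le_iff₀ (by positivity)]
    nlinarith
  have hcont : ContinuousOn (fun x => besselEntire ν (x ^ 2 / 4)) (Icc α (α + 2 * Real.pi)) :=
    fun x _ => (hasDerivAt_besselEntire_sq (by linarith) x).continuousAt.continuousWithinAt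
  have hsign : (∀ x ∈ Icc α (α + 2 * Real.pi), 0 < besselEntire ν (x ^ 2 / 4)) ∨
      ∀ x ∈ Icc α (α + 2 * Real.pi), besselEntire ν (x ^ 2 / 4) < 0 := by
    by_contra! h
    obtain ⟨⟨x, hx, hx'⟩, y, hy, hy'⟩ := h
    obtain ⟨z, hz, hz'⟩ := isPreconnected_Icc.intermediate_value hx hy hcont ⟨hx', hy'⟩
    exact hne z hz hz'
  rcases hsign with h | h
  · exact not_pos_of_sturm (fun x hx => hasDerivAt_rpow_mul_besselEntire hν (hx0 x hx))
      (fun x hx => hasDerivAt_deriv_rpow_mul_besselEntire hν (hx0 x hx)) hq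
      fun x hx => mul_pos (Real.rpow_pos_of_pos (hx0 x hx) _) (h x hx)
  · exact not_pos_of_sturm (fun x hx => (hasDerivAt_rpow_mul_besselEntire hν (hx0 x hx)).neg)
      (fun x hx => (hasDerivAt_deriv_rpow_mul_besselEntire hν (hx0 x hx)).neg.congr_deriv
        (by simp only [Pi.neg_apply]; ring)) hq
      fun x hx => neg_pos.2 (mul_neg_of_pos_of_neg (Real.rpow_pos_of_pos (hx0 x hx) _) (h x hx))

/-! ### Enumeration of the zeros -/

lemma eventually_besselEntire_sq_ne_zero {a : ℝ} (ha : -1 < a) (x : ℝ) :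
    ∀ᶠ y in 𝓝[≠] x, besselEntire (order a) (y ^ 2 / 4) ≠ 0 := by
  have hν := order_pos ha
  have hd := hasDerivAt_besselEntire_sq (μ := order a) (by linarith) x
  by_cases h0 : besselEntire (order a) (x ^ 2 / 4) = 0
  · refine hd.eventually_ne ?_
    have h1 := besselEntire_sub_one_ne_zero ha h0
    rw [besselEntire_sub_one hν, h0] at h1
    intro h
    apply h1
    -- At a zero of φ_ν the recurrence reads φ_{ν-1} = -(x²/4) φ_{ν+1}, which is x/2 times the
    -- derivative.
    linear_combination x / 2 * h
  · exact nhdsWithin_le_nhds (hd.continuousAt.eventually_ne h0)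

/-- Enumeration in ascending order of an unbounded set of positive zeros without accumulation
points in `[0, ∞)`. -/
lemma besselZero_props {a : ℝ} (ha : -1 < a) (k : ℕ) :
    0 ≤ besselZero (order a) k ∧ besselZero (order a) k < besselZero (order a) (k + 1) ∧
      besselJ (order a) (besselZero (order a) (k + 1)) = 0 ∧
      ∀ x, besselZero (order a) k < x → besselJ (order a) x = 0 →
        besselZero (order a) (k + 1) ≤ x := by
  have hν := order_pos ha
  have step : ∀ k, 0 ≤ besselZero (order a) k →
      besselZero (order a) k < besselZero (order a) (k + 1) ∧
      besselJ (order a) (besselZero (order a) (k + 1)) = 0 ∧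
      ∀ x, besselZero (order a) k < x → besselJ (order a) x = 0 →
        besselZero (order a) (k + 1) ≤ x := by
    intro k hk
    set b := besselZero (order a) k
    set S := {x : ℝ | b < x ∧ besselJ (order a) x = 0} with hS
    have hb1 : besselZero (order a) (k + 1) = sInf S := rfl
    have hbdd : BddBelow S := ⟨b, fun x hx => hx.1.le⟩
    have hne : S.Nonempty := by
      obtain ⟨x, hx, hx0⟩ := exists_zero_besselEntire hν (α := 2 * order a + b + 1) (by linarith)
      have h1 := hx.1
      exact ⟨x, by linarith, (besselJ_eq_zero_iff (by linarith) _).2 hx0⟩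
    -- Isolation of zeros around b keeps the infimum away from b; this covers b = 0 as well.
    have hlt : b < sInf S := by
      have h := eventually_besselEntire_sq_ne_zero ha b
      rw [eventually_nhdsWithin_iff, Metric.eventually_nhds_iff] at h
      obtain ⟨ε, hε, h⟩ := h
      refine lt_of_lt_of_le (by linarith : b < b + ε) (le_csInf hne fun x hx => ?_)
      by_contra! hlt
      have hx1 : b < x := hx.1
      refine h (y := x) ?_ hx1.ne' ((besselJ_eq_zero_iff (by linarith) _).1 hx.2)
      rw [Real.dist_eq, abs_of_pos (by linarith)]
      linarith
    refine ⟨hlt, ?_, fun x hx hx0 => csInf_le hbdd ⟨hx, hx0⟩⟩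
    rw [hb1, besselJ_eq_zero_iff (by linarith)]
    have hcl : IsClosed {x : ℝ | besselEntire (order a) (x ^ 2 / 4) = 0} :=
      isClosed_eq ((continuous_besselEntire (by linarith)).comp (by fun_prop)) continuous_const
    have hsub : S ⊆ {x : ℝ | besselEntire (order a) (x ^ 2 / 4) = 0} := fun x hx => by
      have hx1 : b < x := hx.1
      exact (besselJ_eq_zero_iff (by linarith) _).1 hx.2
    exact closure_minimal hsub hcl (csInf_mem_closure hne hbdd)
  have hnn : 0 ≤ besselZero (order a) k := by
    induction k with
    | zero => exact le_rfl
    | succ k ih => exact ih.trans (step k ih).1.le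
  exact ⟨hnn, step k hnn⟩

lemma strictMono_besselZero {a : ℝ} (ha : -1 < a) : StrictMono (besselZero (order a)) :=
  strictMono_nat_of_lt_succ fun k => (besselZero_props ha k).2.1

lemma besselZero_pos {a : ℝ} (ha : -1 < a) (k : ℕ+) : 0 < besselZero (order a) k :=
  strictMono_besselZero ha k.pos

lemma besselJ_besselZero {a : ℝ} (ha : -1 < a) (k : ℕ+) :
    besselJ (order a) (besselZero (order a) k) = 0 := by
  have := (besselZero_props ha (k - 1 : ℕ)).2.2.1
  rwa [Nat.sub_add_cancel k.pos] at this

lemma exists_eq_besselZero {a : ℝ} (ha : -1 < a) {x : ℝ} (hx : 0 < x)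
    (h0 : besselJ (order a) x = 0) : ∃ k : ℕ+, besselZero (order a) k = x := by
  have hν := order_pos ha
  have hmono := strictMono_besselZero ha
  have hex : ∃ k, x ≤ besselZero (order a) k := by
    by_contra! hlt
    -- If all terms stayed below x, the strictly increasing zeros would accumulate at L, against
    -- their isolation.
    set L := ⨆ k, besselZero (order a) k
    have hbdd : BddAbove (range (besselZero (order a))) :=
      ⟨x, by rintro _ ⟨k, rfl⟩; exact (hlt k).le⟩
    have hlim : Tendsto (besselZero (order a)) atTop (𝓝 L) :=
      tendsto_atTop_ciSup hmono.monotone hbdd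
    have hle : ∀ k, besselZero (order a) k < L := fun k =>
      (hmono k.lt_succ_self).trans_le (le_ciSup hbdd _)
    have hlim' : Tendsto (besselZero (order a)) atTop (𝓝[≠] L) :=
      tendsto_nhdsWithin_iff.2 ⟨hlim, Eventually.of_forall fun k => (hle k).ne⟩
    have hev := hlim'.eventually (eventually_besselEntire_sq_ne_zero ha L)
    -- Index 0 is excluded because its value 0 is only the start of the recursion.
    obtain ⟨k, hk, hk1⟩ := (hev.and (eventually_ge_atTop 1)).exists
    exact hk ((besselJ_eq_zero_iff (besselZero_pos ha ⟨k, hk1⟩) _).1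
      (besselJ_besselZero ha ⟨k, hk1⟩))
  classical
  have hk := Nat.find_spec hex
  have hpos : 0 < Nat.find hex := by
    rw [Nat.find_pos]
    exact not_le.2 hx
  refine ⟨⟨Nat.find hex, hpos⟩, le_antisymm ?_ hk⟩
  have hmin := Nat.find_min hex (Nat.sub_one_lt hpos.ne')
  have := (besselZero_props ha (Nat.find hex - 1)).2.2.2 x (not_le.1 hmin) h0
  rwa [Nat.sub_add_cancel hpos] at this

/-! ### The zeros of order 1/2 -/

lemma order_one : order 1 = 1 / 2 := by norm_num [order]

lemma besselJ_half_eq_zero_iff {x : ℝ} (hx : 0 < x) :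
    besselJ (1 / 2) x = 0 ↔ Real.sin x = 0 := by
  rw [besselJ_eq_zero_iff hx]
  have h := besselEntire_half (x := x)
  have hp : 2 / √Real.pi ≠ 0 := by positivity
  constructor
  · intro h0
    rw [h0, zero_mul] at h
    simpa [hp] using h.symm
  · intro h0
    rw [h0, mul_zero] at h
    simpa [hx.ne'] using h

lemma besselZero_half (k : ℕ) : besselZero (1 / 2) k = k * Real.pi := by
  have hpi := Real.pi_pos
  induction k with
  | zero => simp [besselZero]
  | succ k ih =>
    have hle : IsLeast {x : ℝ | besselZero (1 / 2) k < x ∧ besselJ (1 / 2) x = 0}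
        ((k + 1 : ℕ) * Real.pi) := by
      rw [ih]
      refine ⟨⟨by push_cast; linarith, ?_⟩, ?_⟩
      · rw [besselJ_half_eq_zero_iff (by positivity)]
        exact Real.sin_nat_mul_pi _
      · rintro x ⟨hx, hx0⟩
        have hk : (0 : ℝ) ≤ k := k.cast_nonneg
        have hx' : 0 < x := lt_of_le_of_lt (by positivity) hx
        rw [besselJ_half_eq_zero_iff hx', Real.sin_eq_zero_iff] at hx0
        obtain ⟨n, rfl⟩ := hx0
        have h1 : (k : ℝ) < n := lt_of_mul_lt_mul_right hx hpi.le
        have h2 : (k : ℤ) + 1 ≤ n := by exact_mod_cast h1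
        have h3 : ((k + 1 : ℕ) : ℝ) ≤ n := by exact_mod_cast h2
        gcongr
    exact hle.csInf_eq

/-! ### The weighted measure -/

instance (a : ℝ) : SFinite (weightMeasure a) := by
  unfold weightMeasure; infer_instance

lemma measurable_weight (a : ℝ) :
    Measurable fun t : ℝ => ENNReal.ofReal (Real.exp (-(a * t))) := by fun_prop

/-- The point 0 is null and the density is positive, so the null sets are the same. -/
lemma ae_weightMeasure_iff {a : ℝ} {p : ℝ → Prop} :
    (∀ᵐ t ∂weightMeasure a, p t) ↔ ∀ᵐ t ∂volume.restrict (Ioi (0 : ℝ)), p t := by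
  rw [weightMeasure, ← restrict_Ioi_eq_restrict_Ici]
  have h1 := withDensity_absolutelyContinuous (volume.restrict (Ioi (0 : ℝ)))
    fun t : ℝ => ENNReal.ofReal (Real.exp (-(a * t)))
  have h2 := withDensity_absolutelyContinuous' (μ := volume.restrict (Ioi (0 : ℝ)))
    (measurable_weight a).aemeasurable
    (ae_of_all _ fun t => by simpa using Real.exp_pos _)
  exact ⟨fun h => h2.ae_le h, fun h => h1.ae_le h⟩

lemma integrable_weightMeasure_iff {a : ℝ} {f : ℝ → ℝ} :
    Integrable f (weightMeasure a) ↔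
      IntegrableOn (fun t => f t * Real.exp (-(a * t))) (Ioi 0) := by
  rw [weightMeasure, ← restrict_Ioi_eq_restrict_Ici,
    integrable_withDensity_iff_integrable_smul' (measurable_weight a) (by simp), IntegrableOn]
  simp only [ENNReal.toReal_ofReal (Real.exp_pos _).le, smul_eq_mul, mul_comm]

lemma integral_weightMeasure {a : ℝ} (f : ℝ → ℝ) :
    ∫ t, f t ∂weightMeasure a = ∫ t in Ioi 0, f t * Real.exp (-(a * t)) := by
  rw [weightMeasure, ← restrict_Ioi_eq_restrict_Ici,
    integral_withDensity_eq_integral_toReal_smul (measurable_weight a) (by simp)]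
  simp only [ENNReal.toReal_ofReal (Real.exp_pos _).le, smul_eq_mul, mul_comm]

lemma memLp_exp_half {a : ℝ} (ha : -1 < a) :
    MemLp (fun t => Real.exp (-(t / 2))) 2 (weightMeasure a) := by
  rw [memLp_two_iff_integrable_sq (by fun_prop), integrable_weightMeasure_iff]
  refine (integrableOn_exp_neg_mul (b := a + 1) (by linarith) 0).congr_fun (fun t _ => ?_)
    measurableSet_Ioi
  simp only [← Real.exp_nat_mul, ← Real.exp_add]
  push_cast
  ring_nf

/-! ### Boundedness of the integral operator -/

lemma K0_nonneg {s t : ℝ} (hs : 0 ≤ s) (ht : 0 ≤ t) : 0 ≤ K0 s t := by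
  rw [K0, sub_nonneg]
  apply Real.exp_le_exp.2
  have := max_le_add_of_nonneg hs ht
  linarith

/-- Since max(s, t) ≥ (s + t)/2, the kernel lies below a rank-one kernel whose factor e^{-t/2} is in
H_a for a > -1. Existence and boundedness of the operator follow by Cauchy–Schwarz. -/
lemma K0_le {s t : ℝ} : K0 s t ≤ Real.exp (-(s / 2)) * Real.exp (-(t / 2)) := by
  rw [K0, ← Real.exp_add]
  refine (sub_le_self _ (Real.exp_pos _).le).trans (Real.exp_le_exp.2 ?_)
  linarith [le_max_left s t, le_max_right s t]

lemma abs_K0_mul_le {s t : ℝ} (hs : 0 ≤ s) (ht : 0 ≤ t) (y : ℝ) :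
    |K0 s t * y| ≤ Real.exp (-(s / 2)) * (Real.exp (-(t / 2)) * |y|) := by
  rw [abs_mul, abs_of_nonneg (K0_nonneg hs ht), ← mul_assoc]
  gcongr
  exact K0_le

lemma continuous_K0 : Continuous fun z : ℝ × ℝ => K0 z.1 z.2 := by
  unfold K0; fun_prop

lemma integrable_exp_half_mul_abs {a : ℝ} (ha : -1 < a) (f : Ha a) :
    Integrable (fun t => Real.exp (-(t / 2)) * |f t|) (weightMeasure a) :=
  (memLp_exp_half ha).integrable_mul (Lp.memLp f).abs

lemma ae_nonneg_weightMeasure (a : ℝ) : ∀ᵐ t ∂weightMeasure a, 0 ≤ t :=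
  ae_weightMeasure_iff.2 <| by
    filter_upwards [ae_restrict_mem measurableSet_Ioi] with t ht using le_of_lt ht

lemma integrable_K0_mul {a : ℝ} (ha : -1 < a) (f : Ha a) {s : ℝ} (hs : 0 ≤ s) :
    Integrable (fun t => K0 s t * f t) (weightMeasure a) := by
  refine ((integrable_exp_half_mul_abs ha f).const_mul (Real.exp (-(s / 2)))).mono'
    ((continuous_K0.comp (Continuous.prodMk_right s)).aestronglyMeasurable.mul
      (Lp.aestronglyMeasurable f)) ?_
  filter_upwards [ae_nonneg_weightMeasure a] with t ht using abs_K0_mul_le hs ht _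

/-- The function `s ↦ ∫ K₀(s, t) f(t) e^{-at} dt`. -/
def covFun (a : ℝ) (f : Ha a) (s : ℝ) : ℝ := ∫ t, K0 s t * f t ∂weightMeasure a

lemma covFun_eq {a : ℝ} (f : Ha a) (s : ℝ) :
    covFun a f s = ∫ t in Ioi 0, K0 s t * f t * Real.exp (-(a * t)) :=
  integral_weightMeasure _

/-- The element `e^{-t/2}` of `H_a`, which dominates the kernel. -/
def expHalf {a : ℝ} (ha : -1 < a) : Ha a := (memLp_exp_half ha).toLp _

lemma integral_exp_half_mul_abs_le {a : ℝ} (ha : -1 < a) (f : Ha a) :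
    ∫ t, Real.exp (-(t / 2)) * |f t| ∂weightMeasure a ≤ ‖expHalf ha‖ * ‖f‖ := by
  have h : ∫ t, Real.exp (-(t / 2)) * |f t| ∂weightMeasure a = inner ℝ (expHalf ha) |f| := by
    rw [L2.inner_def]
    refine integral_congr_ae ?_
    filter_upwards [(memLp_exp_half ha).coeFn_toLp, Lp.coeFn_abs f] with t h1 h2
    rw [expHalf, h1, h2]
    simp [mul_comm]
  rw [h, ← norm_abs_eq_norm f]
  exact real_inner_le_norm _ _

lemma abs_covFun_le {a : ℝ} (ha : -1 < a) (f : Ha a) {s : ℝ} (hs : 0 ≤ s) :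
    |covFun a f s| ≤ (‖expHalf ha‖ * ‖f‖) * Real.exp (-(s / 2)) := by
  have h1 : ‖covFun a f s‖ ≤
      ∫ t, Real.exp (-(s / 2)) * (Real.exp (-(t / 2)) * |f t|) ∂weightMeasure a :=
    norm_integral_le_of_norm_le ((integrable_exp_half_mul_abs ha f).const_mul _) <| by
      filter_upwards [ae_nonneg_weightMeasure a] with t ht using abs_K0_mul_le hs ht _
  rw [integral_const_mul] at h1
  refine h1.trans ?_
  rw [mul_comm]
  gcongr
  exact integral_exp_half_mul_abs_le ha f

lemma aestronglyMeasurable_covFun {a : ℝ} (f : Ha a) :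
    AEStronglyMeasurable (covFun a f) (weightMeasure a) := by
  have h : StronglyMeasurable fun z : ℝ × ℝ => K0 z.1 z.2 * f z.2 :=
    continuous_K0.stronglyMeasurable.mul ((Lp.stronglyMeasurable f).comp_measurable measurable_snd)
  exact h.integral_prod_right.aestronglyMeasurable

lemma ae_abs_covFun_le {a : ℝ} (ha : -1 < a) (f : Ha a) :
    ∀ᵐ s ∂weightMeasure a,
      ‖covFun a f s‖ ≤ (‖expHalf ha‖ * ‖f‖) * ‖Real.exp (-(s / 2))‖ := by
  filter_upwards [ae_nonneg_weightMeasure a] with s hs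
  simpa [Real.norm_eq_abs] using abs_covFun_le ha f hs

lemma memLp_covFun {a : ℝ} (ha : -1 < a) (f : Ha a) :
    MemLp (covFun a f) 2 (weightMeasure a) :=
  (memLp_exp_half ha).of_le_mul (aestronglyMeasurable_covFun f) (ae_abs_covFun_le ha f)

/-- The integral operator with kernel `K₀` on `H_a`. -/
def covOperator {a : ℝ} (ha : -1 < a) : Ha a →L[ℝ] Ha a :=
  LinearMap.mkContinuous
    { toFun := fun f => (memLp_covFun ha f).toLp _
      map_add' := fun f g => by
        rw [← MemLp.toLp_add]
        refine MemLp.toLp_congr _ _ ?_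
        filter_upwards [ae_nonneg_weightMeasure a] with s hs
        rw [Pi.add_apply, covFun, covFun, covFun,
          ← integral_add (integrable_K0_mul ha f hs) (integrable_K0_mul ha g hs)]
        refine integral_congr_ae ?_
        filter_upwards [Lp.coeFn_add f g] with t ht
        rw [ht, Pi.add_apply, mul_add]
      map_smul' := fun r f => by
        rw [RingHom.id_apply, ← MemLp.toLp_const_smul]
        refine MemLp.toLp_congr _ _ (ae_of_all _ fun s => ?_)
        rw [Pi.smul_apply, smul_eq_mul, covFun, covFun, ← integral_const_mul]
        refine integral_congr_ae ?_
        filter_upwards [Lp.coeFn_smul r f] with t ht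
        rw [ht, Pi.smul_apply, smul_eq_mul]
        ring }
    (‖expHalf ha‖ * ‖expHalf ha‖) fun f => by
      rw [mul_right_comm]
      refine Lp.norm_le_mul_norm_of_ae_le_mul ?_
      filter_upwards [ae_abs_covFun_le ha f, (memLp_covFun ha f).coeFn_toLp,
        (memLp_exp_half ha).coeFn_toLp] with s h1 h2 h3
      change ‖((memLp_covFun ha f).toLp _ : Ha a) s‖ ≤ _ * ‖((memLp_exp_half ha).toLp _ : Ha a) s‖
      rw [h2, h3]
      exact h1

lemma coeFn_covOperator {a : ℝ} (ha : -1 < a) (f : Ha a) :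
    covOperator ha f =ᵐ[weightMeasure a] covFun a f := (memLp_covFun ha f).coeFn_toLp

lemma isCovOperator_covOperator {a : ℝ} (ha : -1 < a) : IsCovOperator a (covOperator ha) := by
  refine fun f => ⟨fun s hs => integrable_weightMeasure_iff.1 (integrable_K0_mul ha f hs.le), ?_⟩
  filter_upwards [coeFn_covOperator ha f] with s hs
  rw [hs, covFun_eq]

/-! ### The continuous representative of the image -/

/-- The integrand of the part of `covFun` below the diagonal, extended by zero. -/
def lowerIntegrand (a : ℝ) (f : Ha a) : ℝ → ℝ :=
  indicator (Ioi 0) fun t => (1 - Real.exp (-t)) * (f t * Real.exp (-(a * t)))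

/-- The integrand of the part of `covFun` above the diagonal, extended by zero. -/
def upperIntegrand (a : ℝ) (f : Ha a) : ℝ → ℝ :=
  indicator (Ioi 0) fun t => Real.exp (-t) * (f t * Real.exp (-(a * t)))

lemma integrableOn_upper {a : ℝ} (ha : -1 < a) (f : Ha a) :
    IntegrableOn (fun t => Real.exp (-t) * (f t * Real.exp (-(a * t)))) (Ioi 0) := by
  have h : Integrable (fun t => Real.exp (-t) * f t) (weightMeasure a) := by
    refine (integrable_exp_half_mul_abs ha f).mono'
      ((by fun_prop : Continuous fun t : ℝ => Real.exp (-t)).aestronglyMeasurable.mul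
        (Lp.aestronglyMeasurable f)) ?_
    filter_upwards [ae_nonneg_weightMeasure a] with t ht
    rw [Real.norm_eq_abs, abs_mul, Real.abs_exp]
    gcongr
    linarith
  simpa only [mul_assoc] using integrable_weightMeasure_iff.1 h

/-- On (0, s] the integrand is e^s K₀(s, t) f(t) e^{-at}. Integrability over (0, ∞) may fail for a ≤
0, where constants are not in H_a. -/
lemma integrableOn_lower {a : ℝ} (ha : -1 < a) (f : Ha a) (s : ℝ) :
    IntegrableOn (fun t => (1 - Real.exp (-t)) * (f t * Real.exp (-(a * t)))) (Ioc 0 s) := by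
  rcases le_total s 0 with hs | hs
  · simp [Ioc_eq_empty (not_lt.2 hs)]
  have h := ((integrable_weightMeasure_iff.1 (integrable_K0_mul ha f hs)).mono_set
    (Ioc_subset_Ioi_self : Ioc 0 s ⊆ Ioi 0)).const_mul (Real.exp s)
  refine IntegrableOn.congr_fun h (fun t ht => ?_) measurableSet_Ioc
  simp only [K0_of_le ht.2]
  have : Real.exp s * Real.exp (-s) = 1 := by rw [← Real.exp_add]; simp
  linear_combination ((1 - Real.exp (-t)) * (f t * Real.exp (-(a * t)))) * this

lemma integrable_upperIntegrand {a : ℝ} (ha : -1 < a) (f : Ha a) :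
    Integrable (upperIntegrand a f) :=
  (integrable_indicator_iff measurableSet_Ioi).2 (integrableOn_upper ha f)

lemma intervalIntegrable_lowerIntegrand {a : ℝ} (ha : -1 < a) (f : Ha a) (x y : ℝ) :
    IntervalIntegrable (lowerIntegrand a f) volume x y := by
  rw [intervalIntegrable_iff, lowerIntegrand, integrableOn_indicator_iff measurableSet_Ioi]
  refine (integrableOn_lower ha f (max x y)).mono_set fun t ht => ⟨ht.1, ht.2.2⟩

lemma locallyIntegrable_lowerIntegrand {a : ℝ} (ha : -1 < a) (f : Ha a) :
    LocallyIntegrable (lowerIntegrand a f) volume := by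
  intro x
  refine ⟨Ioc (x - 1) (x + 1), Ioc_mem_nhds (by linarith) (by linarith), ?_⟩
  exact (intervalIntegrable_iff_integrableOn_Ioc_of_le (by linarith)).1
    (intervalIntegrable_lowerIntegrand ha f _ _)

/-- `∫₀^s (1 - e^{-t}) f(t) e^{-at} dt` -/
def lowerInt (a : ℝ) (f : Ha a) (s : ℝ) : ℝ := ∫ t in (0 : ℝ)..s, lowerIntegrand a f t

/-- `∫_s^∞ e^{-t} f(t) e^{-at} dt` -/
def upperInt (a : ℝ) (f : Ha a) (s : ℝ) : ℝ :=
  (∫ t in Ioi 0, upperIntegrand a f t) - ∫ t in (0 : ℝ)..s, upperIntegrand a f t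

lemma continuous_lowerInt {a : ℝ} (ha : -1 < a) (f : Ha a) : Continuous (lowerInt a f) :=
  intervalIntegral.continuous_primitive (intervalIntegrable_lowerIntegrand ha f) 0

lemma continuous_upperInt {a : ℝ} (ha : -1 < a) (f : Ha a) : Continuous (upperInt a f) :=
  continuous_const.sub (intervalIntegral.continuous_primitive
    (fun _ _ => (integrable_upperIntegrand ha f).intervalIntegrable) 0)

/-- The continuous representative of `T f`. -/
def covRep (a : ℝ) (f : Ha a) (s : ℝ) : ℝ :=
  Real.exp (-s) * lowerInt a f s + (1 - Real.exp (-s)) * upperInt a f s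

lemma continuous_covRep {a : ℝ} (ha : -1 < a) (f : Ha a) : Continuous (covRep a f) := by
  have h1 := continuous_lowerInt ha f
  have h2 := continuous_upperInt ha f
  unfold covRep
  fun_prop

lemma covFun_eq_covRep {a : ℝ} (ha : -1 < a) (f : Ha a) {s : ℝ} (hs : 0 ≤ s) :
    covFun a f s = covRep a f s := by
  rw [covFun_eq]
  simp only [mul_assoc]
  rw [integral_K0_mul hs (integrableOn_lower ha f s)
    ((integrableOn_upper ha f).mono_set (Ioi_subset_Ioi hs)), covRep, lowerInt, upperInt,
    intervalIntegral.integral_of_le hs, intervalIntegral.integral_of_le hs]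
  congr 2
  · refine setIntegral_congr_fun measurableSet_Ioc fun t ht => ?_
    simp [lowerIntegrand, indicator_of_mem (show t ∈ Ioi (0 : ℝ) from ht.1)]
  · have h1 := (integrable_upperIntegrand ha f).integrableOn (s := Ioc 0 s)
    have h2 := (integrable_upperIntegrand ha f).integrableOn (s := Ioi s)
    have h3 := setIntegral_union (Ioc_disjoint_Ioi le_rfl) measurableSet_Ioi h1 h2
    rw [Ioc_union_Ioi_eq_Ioi hs] at h3
    rw [h3, add_sub_cancel_left]
    refine setIntegral_congr_fun measurableSet_Ioi fun t ht => ?_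
    simp [upperIntegrand, indicator_of_mem (show t ∈ Ioi (0 : ℝ) from lt_of_le_of_lt hs ht)]

lemma tendsto_upperInt {a : ℝ} (ha : -1 < a) (f : Ha a) :
    Tendsto (upperInt a f) atTop (𝓝 0) := by
  have h := intervalIntegral_tendsto_integral_Ioi 0
    ((integrable_upperIntegrand ha f).integrableOn (s := Ioi 0)) tendsto_id
  have h' := h.const_sub (∫ t in Ioi 0, upperIntegrand a f t)
  rw [sub_self] at h'
  exact h'

lemma tendsto_covRep {a : ℝ} (ha : -1 < a) (f : Ha a) :
    Tendsto (covRep a f) atTop (𝓝 0) := by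
  have h : Tendsto (fun s => (‖expHalf ha‖ * ‖f‖) * Real.exp (-((1 / 2) * s))) atTop (𝓝 0) := by
    simpa using (tendsto_exp_neg_mul (b := 1 / 2) (by norm_num)).const_mul (‖expHalf ha‖ * ‖f‖)
  refine squeeze_zero_norm' ?_ h
  filter_upwards [eventually_ge_atTop 0] with s hs
  rw [← covFun_eq_covRep ha f hs, Real.norm_eq_abs, show 1 / 2 * s = s / 2 by ring]
  exact abs_covFun_le ha f hs

lemma eq_of_ae_eq_Ioi {g h : ℝ → ℝ} (hg : Continuous g) (hh : Continuous h)
    (hgh : ∀ᵐ t ∂volume.restrict (Ioi (0 : ℝ)), g t = h t) {s : ℝ} (hs : 0 ≤ s) : g s = h s := by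
  have h1 : EqOn g h (Ioi 0) :=
    MeasureTheory.Measure.eqOn_open_of_ae_eq hgh isOpen_Ioi hg.continuousOn hh.continuousOn
  have h2 := h1.closure hg hh
  rw [closure_Ioi] at h2
  exact h2 hs

/-! ### Zero is not an eigenvalue -/

/-- The integral operator is injective. -/
lemma eq_zero_of_covFun_ae_eq_zero {a : ℝ} (ha : -1 < a) (f : Ha a)
    (h : ∀ᵐ s ∂weightMeasure a, covFun a f s = 0) : f = 0 := by
  rw [ae_weightMeasure_iff] at h
  have hH : ∀ s, 0 ≤ s → covRep a f s = 0 := fun s hs => by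
    refine eq_of_ae_eq_Ioi (continuous_covRep ha f) continuous_const ?_ hs
    filter_upwards [h, ae_restrict_mem measurableSet_Ioi] with t ht ht'
    rw [← covFun_eq_covRep ha f (le_of_lt ht'), ht]
  have dA := ae_restrict_of_ae (s := Ioi 0)
    (LocallyIntegrable.ae_hasDerivAt_integral (locallyIntegrable_lowerIntegrand ha f))
  have dB := ae_restrict_of_ae (s := Ioi 0)
    (LocallyIntegrable.ae_hasDerivAt_integral (integrable_upperIntegrand ha f).locallyIntegrable)
  -- With A, B the lower and upper integrals, the terms in A' and B' cancel almost everywhere in the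
  -- derivative of e^{-s} A + (1 - e^{-s}) B, leaving -e^{-s}(A - B). So A = B, then both vanish on
  -- [0, ∞), and A' = 0 gives f = 0 almost everywhere.
  have hAB : ∀ s, 0 ≤ s → lowerInt a f s = upperInt a f s := fun s hs => by
    refine eq_of_ae_eq_Ioi (continuous_lowerInt ha f) (continuous_upperInt ha f) ?_ hs
    filter_upwards [dA, dB, ae_restrict_mem measurableSet_Ioi] with t h1 h2 ht
    have d1 : HasDerivAt (lowerInt a f) (lowerIntegrand a f t) t := h1 0
    have d2 : HasDerivAt (upperInt a f) (-upperIntegrand a f t) t := (h2 0).const_sub _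
    have d3 : HasDerivAt (covRep a f) _ t := ((hasDerivAt_exp_neg' t).mul d1).add
      (((hasDerivAt_exp_neg' t).const_sub 1).mul d2)
    have d4 : HasDerivAt (covRep a f) 0 t := (hasDerivAt_const t (0 : ℝ)).congr_of_eventuallyEq <| by
      filter_upwards [Ioi_mem_nhds ht] with s hs using hH s (le_of_lt hs)
    have h5 := d3.unique d4
    have e : Real.exp (-t) * lowerIntegrand a f t = (1 - Real.exp (-t)) * upperIntegrand a f t := by
      rw [lowerIntegrand, upperIntegrand, indicator_of_mem ht, indicator_of_mem ht]
      ring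
    refine mul_left_cancel₀ (Real.exp_pos (-t)).ne' ?_
    linear_combination e - h5
  have hA : ∀ s, 0 ≤ s → lowerInt a f s = 0 := fun s hs => by
    have h1 := hH s hs
    rw [covRep, ← hAB s hs] at h1
    linear_combination h1
  rw [Lp.eq_zero_iff_ae_eq_zero]
  refine ae_weightMeasure_iff.2 ?_
  filter_upwards [dA, ae_restrict_mem measurableSet_Ioi] with t h1 ht
  have d1 : HasDerivAt (lowerInt a f) (lowerIntegrand a f t) t := h1 0
  have d4 : HasDerivAt (lowerInt a f) 0 t := (hasDerivAt_const t (0 : ℝ)).congr_of_eventuallyEq <| by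
    filter_upwards [Ioi_mem_nhds ht] with s hs using hA s (le_of_lt hs)
  have h5 := d1.unique d4
  rw [lowerIntegrand, indicator_of_mem ht] at h5
  have h6 : 1 - Real.exp (-t) ≠ 0 := by
    have : Real.exp (-t) < 1 := by simpa using ht
    linarith
  simpa [h6, (Real.exp_pos _).ne'] using h5

/-! ### Eigenfunctions solve the system -/

/-- Uniqueness for the Sturm–Liouville system with zero Cauchy data at `0`. -/
lemma eq_zero_of_system {a : ℝ} (ha : -1 < a) {κ : ℝ} {H p : ℝ → ℝ}
    (hH : ∀ s, 0 ≤ s → HasDerivAt H (-(Real.exp (-s) * p s)) s)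
    (hp : ∀ s, 0 ≤ s → HasDerivAt p (κ * (Real.exp (-(a * s)) * H s)) s)
    (hH0 : H 0 = 0) (hp0 : p 0 = 0) {s : ℝ} (hs : 0 ≤ s) : H s = 0 := by
  -- Grönwall argument for H and q = e^{-t} p. The rescaling matters: q' = -q + κ e^{-(a+1)t} H has
  -- bounded coefficients on [0, ∞) even when e^{-at} grows.
  set C := 1 + |κ| with hC
  have hd : ∀ t, 0 ≤ t → HasDerivAt
      (fun t => Real.exp (-(C * t)) * (H t ^ 2 + (Real.exp (-t) * p t) ^ 2))
      (Real.exp (-(C * t)) * (-C * (H t ^ 2 + (Real.exp (-t) * p t) ^ 2)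
        + 2 * (-1 + κ * Real.exp (-((a + 1) * t))) * (H t * (Real.exp (-t) * p t))
        - 2 * (Real.exp (-t) * p t) ^ 2)) t := by
    intro t ht
    refine ((hasDerivAt_exp_neg_mul C t).mul (((hH t ht).pow 2).add
      (((hasDerivAt_exp_neg' t).mul (hp t ht)).pow 2))).congr_deriv ?_
    have e : Real.exp (-((a + 1) * t)) = Real.exp (-(a * t)) * Real.exp (-t) := by
      rw [← Real.exp_add]; ring_nf
    simp only [Pi.pow_apply, Pi.mul_apply, Pi.add_apply]
    rw [e]
    push_cast
    ring
  have hanti : AntitoneOn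
      (fun t => Real.exp (-(C * t)) * (H t ^ 2 + (Real.exp (-t) * p t) ^ 2)) (Ici 0) := by
    refine antitoneOn_of_deriv_nonpos (convex_Ici 0)
      (fun x hx => (hd x hx).continuousAt.continuousWithinAt)
      (fun x hx => (hd x (interior_subset hx)).differentiableAt.differentiableWithinAt)
      fun x hx => ?_
    have hx' : 0 ≤ x := interior_subset hx
    rw [(hd x hx').deriv]
    refine mul_nonpos_of_nonneg_of_nonpos (Real.exp_pos _).le ?_
    set q := Real.exp (-x) * p x
    have h1 : |(-1 + κ * Real.exp (-((a + 1) * x)))| ≤ C := by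
      refine (abs_add_le _ _).trans ?_
      rw [abs_neg, abs_one, abs_mul, Real.abs_exp, hC]
      gcongr
      refine mul_le_of_le_one_right (abs_nonneg _) (Real.exp_le_one_iff.2 ?_)
      have : 0 ≤ (a + 1) * x := mul_nonneg (by linarith) hx'
      linarith
    have h2 : 2 * |H x * q| ≤ H x ^ 2 + q ^ 2 := by
      rw [abs_mul]
      nlinarith [sq_nonneg (|H x| - |q|), sq_abs (H x), sq_abs q]
    have h3 : (-1 + κ * Real.exp (-((a + 1) * x))) * (H x * q) ≤ C * |H x * q| := by
      refine (le_abs_self _).trans ?_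
      rw [abs_mul]
      gcongr
    have h4 : 0 ≤ C := by positivity
    nlinarith [mul_le_mul_of_nonneg_left h2 h4, sq_nonneg q]
  have h := hanti (mem_Ici.2 le_rfl) hs hs
  simp only [hH0, hp0, mul_zero, zero_pow two_ne_zero, add_zero] at h
  have h1 := nonpos_of_mul_nonpos_right h (Real.exp_pos _)
  nlinarith [sq_nonneg (H s), sq_nonneg (Real.exp (-s) * p s)]

/-- An eigenfunction has a continuous representative solving the Sturm–Liouville system. -/
lemma exists_system_of_eigen {a : ℝ} (ha : -1 < a) (f : Ha a) {μ : ℝ} (hμ : μ ≠ 0)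
    (h : ∀ᵐ s ∂weightMeasure a, covFun a f s = μ * f s) :
    ∃ H p : ℝ → ℝ, (∀ s, 0 ≤ s → HasDerivAt H (-(Real.exp (-s) * p s)) s) ∧
      (∀ s, 0 ≤ s → HasDerivAt p (μ⁻¹ * (Real.exp (-(a * s)) * H s)) s) ∧ H 0 = 0 ∧
      Tendsto H atTop (𝓝 0) ∧ Tendsto (fun s => Real.exp (-s) * p s) atTop (𝓝 0) ∧
      ∀ᵐ s ∂weightMeasure a, f s = μ⁻¹ * H s := by
  -- Replacing f by its continuous version g makes the two integrals differentiable everywhere, not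
  -- just almost everywhere.
  set g : ℝ → ℝ := fun s => μ⁻¹ * covRep a f s
  have hg : Continuous g := (continuous_covRep ha f).const_mul _
  have hfg : ∀ᵐ s ∂volume.restrict (Ioi (0 : ℝ)), f s = g s := by
    filter_upwards [ae_weightMeasure_iff.1 h, ae_restrict_mem measurableSet_Ioi] with s h1 hs
    simp only [g]
    rw [← covFun_eq_covRep ha f (le_of_lt hs), h1, inv_mul_cancel_left₀ hμ]
  have hfg' := (ae_restrict_iff' measurableSet_Ioi).1 hfg
  set A : ℝ → ℝ := fun s => ∫ t in (0 : ℝ)..s, (1 - Real.exp (-t)) * (g t * Real.exp (-(a * t)))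
    with hA
  set B : ℝ → ℝ := fun s => upperInt a f 0 -
    ∫ t in (0 : ℝ)..s, Real.exp (-t) * (g t * Real.exp (-(a * t))) with hB
  have hAeq : ∀ s, 0 ≤ s → lowerInt a f s = A s := fun s hs => by
    refine intervalIntegral.integral_congr_ae ?_
    filter_upwards [hfg'] with t ht ht'
    rw [uIoc_of_le hs] at ht'
    have hpos : t ∈ Ioi (0 : ℝ) := ht'.1
    rw [lowerIntegrand, indicator_of_mem hpos, ht hpos]
  have hBeq : ∀ s, 0 ≤ s → upperInt a f s = B s := fun s hs => by
    simp only [hB, upperInt, intervalIntegral.integral_same, sub_zero]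
    congr 1
    refine intervalIntegral.integral_congr_ae ?_
    filter_upwards [hfg'] with t ht ht'
    rw [uIoc_of_le hs] at ht'
    have hpos : t ∈ Ioi (0 : ℝ) := ht'.1
    rw [upperIntegrand, indicator_of_mem hpos, ht hpos]
  have dA : ∀ s, HasDerivAt A ((1 - Real.exp (-s)) * (g s * Real.exp (-(a * s)))) s := fun s =>
    (by fun_prop : Continuous fun t => (1 - Real.exp (-t)) * (g t * Real.exp (-(a * t))))
      |>.integral_hasStrictDerivAt 0 s |>.hasDerivAt
  have dB : ∀ s, HasDerivAt B (-(Real.exp (-s) * (g s * Real.exp (-(a * s))))) s := fun s =>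
    ((by fun_prop : Continuous fun t => Real.exp (-t) * (g t * Real.exp (-(a * t))))
      |>.integral_hasStrictDerivAt 0 s |>.hasDerivAt).const_sub _
  have hHeq : ∀ s, 0 ≤ s →
      covRep a f s = Real.exp (-s) * A s + (1 - Real.exp (-s)) * B s := fun s hs => by
    rw [covRep, hAeq s hs, hBeq s hs]
  refine ⟨fun s => Real.exp (-s) * A s + (1 - Real.exp (-s)) * B s, fun s => A s - B s,
    fun s _ => ?_, fun s hs => ?_, ?_, ?_, ?_, ?_⟩
  · refine (((hasDerivAt_exp_neg' s).mul (dA s)).add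
      (((hasDerivAt_exp_neg' s).const_sub 1).mul (dB s))).congr_deriv ?_
    ring
  · refine ((dA s).sub (dB s)).congr_deriv ?_
    simp only [g, ← hHeq s hs]
    ring
  · simp [hA]
  · refine (tendsto_covRep ha f).congr' ?_
    filter_upwards [eventually_ge_atTop 0] with s hs using hHeq s hs
  -- Here e^{-s}(A - B) = H - B, and both terms on the right tend to 0.
  · have h1 := (tendsto_covRep ha f).sub (tendsto_upperInt ha f)
    rw [sub_zero] at h1
    refine h1.congr' ?_
    filter_upwards [eventually_ge_atTop 0] with s hs
    rw [hHeq s hs, hBeq s hs]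
    ring
  · refine ae_weightMeasure_iff.2 ?_
    filter_upwards [hfg, ae_restrict_mem measurableSet_Ioi] with s h1 hs
    rw [h1, ← hHeq s (le_of_lt hs)]

/-- A solution of the system vanishing at `0` and at infinity has zero Wronskian with `modeFun`. -/
lemma mul_besselEntire_eq_zero_of_system {a : ℝ} (ha : -1 < a) {c : ℝ} {H p : ℝ → ℝ}
    (hH : ∀ s, 0 ≤ s → HasDerivAt H (-(Real.exp (-s) * p s)) s)
    (hp : ∀ s, 0 ≤ s → HasDerivAt p (c * (a + 1) ^ 2 * (Real.exp (-(a * s)) * H s)) s)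
    (hH0 : H 0 = 0) (hHlim : Tendsto H atTop (𝓝 0))
    (hplim : Tendsto (fun s => Real.exp (-s) * p s) atTop (𝓝 0)) :
    p 0 * besselEntire (order a) c = 0 := by
  have hd : ∀ s, 0 ≤ s → HasDerivAt
      (fun s => p s * modeFun a c s - H s * modeMom a c s) 0 s := fun s hs => by
    refine (((hp s hs).mul (hasDerivAt_modeFun ha c s)).sub
      ((hH s hs).mul (hasDerivAt_modeMom ha c s))).congr_deriv ?_
    ring
  have hconst : ∀ s, 0 ≤ s →
      p s * modeFun a c s - H s * modeMom a c s = p 0 * besselEntire (order a) c := fun s hs => by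
    have := constant_of_has_deriv_right_zero (a := 0) (b := s)
      (fun t ht => (hd t ht.1).continuousAt.continuousWithinAt)
      (fun t ht => (hd t ht.1).hasDerivWithinAt) s ⟨hs, le_rfl⟩
    simpa [hH0, modeFun_zero] using this
  have hlim : Tendsto (fun s => p s * modeFun a c s - H s * modeMom a c s) atTop (𝓝 0) := by
    -- The decay of e^{-s} p is paired with the bounded e^s G, and that of H with the bounded P.
    have h := (hplim.mul (tendsto_exp_mul_modeFun ha c)).sub (hHlim.mul (tendsto_modeMom ha c))
    rw [zero_mul, zero_mul, sub_zero] at h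
    refine h.congr fun s => ?_
    have e : Real.exp (-s) * Real.exp s = 1 := by rw [← Real.exp_add]; simp
    linear_combination (p s * modeFun a c s) * e
  refine tendsto_nhds_unique (tendsto_const_nhds.congr' ?_) hlim
  filter_upwards [eventually_ge_atTop 0] with s hs using (hconst s hs).symm

lemma inv_eq_mul_sq {a : ℝ} (ha : -1 < a) (μ : ℝ) :
    μ⁻¹ = order a ^ 2 / μ * (a + 1) ^ 2 := by
  have := order_mul ha
  rw [div_mul_eq_mul_div, ← mul_pow, mul_comm, this, one_pow, one_div]

/-- If φ_ν(c) ≠ 0, the Wronskian identity forces p(0) = 0, and zero Cauchy data give f = 0. -/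
lemma besselEntire_eq_zero_of_eigen {a : ℝ} (ha : -1 < a) (f : Ha a) {μ : ℝ} (hμ : μ ≠ 0)
    (h : ∀ᵐ s ∂weightMeasure a, covFun a f s = μ * f s) (hf : f ≠ 0) :
    besselEntire (order a) (order a ^ 2 / μ) = 0 := by
  obtain ⟨H, p, hH, hp, hH0, hHlim, hplim, hfH⟩ := exists_system_of_eigen ha f hμ h
  by_contra hne
  have hW := mul_besselEntire_eq_zero_of_system ha (c := order a ^ 2 / μ) hH
    (fun s hs => by rw [← inv_eq_mul_sq ha]; exact hp s hs) hH0 hHlim hplim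
  have hp0 : p 0 = 0 := (mul_eq_zero.1 hW).resolve_right hne
  apply hf
  rw [Lp.eq_zero_iff_ae_eq_zero]
  filter_upwards [hfH, ae_nonneg_weightMeasure a] with s h1 hs
  rw [h1, eq_zero_of_system ha hH hp hH0 hp0 hs, mul_zero, Pi.zero_apply]

/-- H and G both vanish at 0 and P(0) ≠ 0, so subtracting the multiple of G that matches p(0) leaves
zero Cauchy data. This is the simplicity of the eigenvalue. -/
lemma exists_eq_modeFun_of_eigen {a : ℝ} (ha : -1 < a) (f : Ha a) {μ : ℝ} (hμ : μ ≠ 0)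
    (h : ∀ᵐ s ∂weightMeasure a, covFun a f s = μ * f s)
    (h0 : besselEntire (order a) (order a ^ 2 / μ) = 0) :
    ∃ r : ℝ, ∀ᵐ s ∂weightMeasure a, f s = r * modeFun a (order a ^ 2 / μ) s := by
  obtain ⟨H, p, hH, hp, hH0, -, -, hfH⟩ := exists_system_of_eigen ha f hμ h
  set c := order a ^ 2 / μ with hc
  have hP0 : modeMom a c 0 ≠ 0 := by
    rw [modeMom_zero]
    exact mul_ne_zero (by linarith) (besselEntire_sub_one_ne_zero ha h0)
  set r := p 0 / modeMom a c 0 with hr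
  refine ⟨μ⁻¹ * r, ?_⟩
  have key : ∀ s, 0 ≤ s → H s - r * modeFun a c s = 0 := fun s hs =>
    eq_zero_of_system ha (κ := μ⁻¹) (H := fun s => H s - r * modeFun a c s)
      (p := fun s => p s - r * modeMom a c s)
      (fun s hs => ((hH s hs).sub ((hasDerivAt_modeFun ha c s).const_mul r)).congr_deriv (by ring))
      (fun s hs => ((hp s hs).sub ((hasDerivAt_modeMom ha c s).const_mul r)).congr_deriv (by
        rw [hc, ← inv_eq_mul_sq ha]; ring))
      (by simp [hH0, modeFun_zero, h0]) (by rw [hr]; field_simp; ring) hs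
  filter_upwards [hfH, ae_nonneg_weightMeasure a] with s h1 hs
  rw [h1]
  linear_combination μ⁻¹ * key s hs

/-! ### Normalised eigenfunctions -/

/-- The argument `z_{ν,k}² / 4` of `φ_ν` belonging to the zero `z_{ν,k}`. -/
def modeParam (a : ℝ) (k : ℕ) : ℝ := besselZero (order a) k ^ 2 / 4

lemma modeParam_pos {a : ℝ} (ha : -1 < a) (k : ℕ+) : 0 < modeParam a k := by
  have := besselZero_pos ha k
  unfold modeParam
  positivity

lemma besselEntire_modeParam {a : ℝ} (ha : -1 < a) (k : ℕ+) :
    besselEntire (order a) (modeParam a k) = 0 :=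
  (besselJ_eq_zero_iff (besselZero_pos ha k) _).1 (besselJ_besselZero ha k)

lemma modeParam_injective {a : ℝ} (ha : -1 < a) :
    Function.Injective fun k : ℕ+ => modeParam a k := by
  intro j k h
  have h1 : besselZero (order a) j ^ 2 = besselZero (order a) k ^ 2 := by
    simp only [modeParam] at h
    linarith
  exact PNat.coe_injective ((strictMono_besselZero ha).injective
    ((pow_left_inj₀ (besselZero_pos ha j).le (besselZero_pos ha k).le two_ne_zero).1 h1))

lemma eigVal_eq {a : ℝ} (k : ℕ) : eigVal a k = order a ^ 2 / modeParam a k := by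
  rw [eigVal, modeParam, div_pow, mul_pow, div_div_eq_mul_div]
  ring

lemma eigVal_pos {a : ℝ} (ha : -1 < a) (k : ℕ+) : 0 < eigVal a k := by
  rw [eigVal_eq]
  have := order_pos ha
  have := modeParam_pos ha k
  positivity

lemma strictAnti_eigVal {a : ℝ} (ha : -1 < a) : StrictAnti fun k : ℕ+ => eigVal a k := by
  intro j k hjk
  have hν := order_pos ha
  have hj := besselZero_pos ha j
  have h := strictMono_besselZero ha (show (j : ℕ) < k from hjk)
  simp only [eigVal]
  have hk := besselZero_pos ha k
  gcongr

/-- The normalising factor between `modeFun` and `eigFun`. -/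
def modeScale (a : ℝ) (k : ℕ) : ℝ :=
  besselZero (order a) k / 2 / (√(order a) * besselEntire (order a - 1) (modeParam a k))

lemma modeScale_ne_zero {a : ℝ} (ha : -1 < a) (k : ℕ+) : modeScale a k ≠ 0 := by
  have h1 := besselZero_pos ha k
  have h2 := Real.sqrt_pos.2 (order_pos ha)
  exact div_ne_zero (by positivity) (mul_ne_zero h2.ne'
    (besselEntire_sub_one_ne_zero ha (besselEntire_modeParam ha k)))

/-- Raising e^{-t/(2ν)} to the power ν gives e^{-t/2}, which completes the other factor e^{-t/2} to
e^{-t}; squaring it gives e^{-(a+1)t} because 1/ν = a + 1. -/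
lemma eigFun_eq {a : ℝ} (ha : -1 < a) (k : ℕ+) (t : ℝ) :
    eigFun a k t = modeScale a k * modeFun a (modeParam a k) t := by
  have hν := order_pos ha
  have hz := besselZero_pos ha k
  have hP := besselEntire_sub_one_ne_zero ha (besselEntire_modeParam ha k)
  have hs : √(order a) ≠ 0 := (Real.sqrt_pos.2 hν).ne'
  rw [eigFun, modeScale, modeFun, besselJ_eq (by positivity), besselJ_eq hz]
  set z := besselZero (order a) k with hzdef
  have e1 : (z * Real.exp (-(t / (2 * order a))) / 2) ^ order a =
      z / 2 * (z / 2) ^ (order a - 1) * Real.exp (-(t / 2)) := by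
    rw [mul_div_right_comm, Real.mul_rpow (by positivity) (Real.exp_pos _).le, ← Real.exp_mul,
      Real.rpow_sub_one (by positivity)]
    congr 1
    · field_simp
    · congr 1
      field_simp
  have e2 : (z * Real.exp (-(t / (2 * order a)))) ^ 2 / 4 =
      modeParam a k * Real.exp (-((a + 1) * t)) := by
    have e3 : -((a + 1) * t) = (2 : ℕ) * -(t / (2 * order a)) := by
      rw [order]
      have : a + 1 ≠ 0 := by linarith
      push_cast
      field_simp
    rw [e3, Real.exp_nat_mul, modeParam, ← hzdef]
    ring
  have e4 : Real.exp (-t) = Real.exp (-(t / 2)) * Real.exp (-(t / 2)) := by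
    rw [← Real.exp_add]; ring_nf
  have e5 : z ^ 2 / 4 = modeParam a k := rfl
  rw [e1, e2, e4, e5]
  have hr : (z / 2) ^ (order a - 1) ≠ 0 := by positivity
  field_simp

lemma continuous_eigFun {a : ℝ} (ha : -1 < a) (k : ℕ+) : Continuous (eigFun a k) := by
  have : eigFun a k = fun t => modeScale a k * modeFun a (modeParam a k) t :=
    funext (eigFun_eq ha k)
  rw [this]
  exact (continuous_modeFun ha _).const_mul _

lemma memLp_eigFun {a : ℝ} (ha : -1 < a) (k : ℕ+) : MemLp (eigFun a k) 2 (weightMeasure a) := by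
  rw [memLp_two_iff_integrable_sq (continuous_eigFun ha k).aestronglyMeasurable,
    integrable_weightMeasure_iff]
  refine IntegrableOn.congr_fun ((integrableOn_modeFun_mul ha (modeParam a k)
    (modeParam a k)).const_mul (modeScale a k ^ 2)) (fun t _ => ?_) measurableSet_Ioi
  simp only [eigFun_eq ha]
  ring

lemma inner_eigFun {a : ℝ} (ha : -1 < a) (j k : ℕ+) :
    inner ℝ ((memLp_eigFun ha j).toLp (eigFun a j)) ((memLp_eigFun ha k).toLp (eigFun a k)) =
      modeScale a j * modeScale a k * ∫ t in Ioi 0,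
        modeFun a (modeParam a j) t * modeFun a (modeParam a k) t * Real.exp (-(a * t)) := by
  rw [L2.inner_def, ← integral_weightMeasure, ← integral_const_mul]
  refine integral_congr_ae ?_
  filter_upwards [(memLp_eigFun ha j).coeFn_toLp, (memLp_eigFun ha k).coeFn_toLp] with t h1 h2
  rw [h1, h2, eigFun_eq ha, eigFun_eq ha]
  simp only [RCLike.inner_apply, conj_trivial]
  ring

lemma orthonormal_eigFun {a : ℝ} (ha : -1 < a) :
    Orthonormal ℝ fun k : ℕ+ => (memLp_eigFun ha k).toLp (eigFun a k) := by
  rw [orthonormal_iff_ite]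
  intro j k
  rw [inner_eigFun ha]
  split_ifs with hjk
  · subst hjk
    have hc := modeParam_pos ha j
    have h0 := besselEntire_modeParam ha j
    have hν := order_pos ha
    have hP := besselEntire_sub_one_ne_zero ha h0
    have hs : √(order a) ≠ 0 := (Real.sqrt_pos.2 hν).ne'
    rw [integral_modeFun_sq ha hc.ne' h0]
    have e : modeScale a j * modeScale a j =
        modeParam a j / (order a * besselEntire (order a - 1) (modeParam a j) ^ 2) := by
      have hsq : √(order a) * √(order a) = order a := Real.mul_self_sqrt hν.le
      rw [modeScale, div_mul_div_comm, mul_mul_mul_comm, hsq]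
      congr 1
      · rw [modeParam]; ring
      · ring
    rw [e]
    field_simp
  · rw [integral_modeFun_mul_eq_zero ha (fun h => hjk (modeParam_injective ha h))
      (besselEntire_modeParam ha j) (besselEntire_modeParam ha k), mul_zero]

/-! ### Eigenvalues and eigenspaces -/

lemma integral_K0_mul_eigFun {a : ℝ} (ha : -1 < a) (k : ℕ+) {s : ℝ} (hs : 0 ≤ s) :
    ∫ t in Ioi 0, K0 s t * eigFun a k t * Real.exp (-(a * t)) = eigVal a k * eigFun a k s := by
  have h := integral_K0_mul_modeFun ha (modeParam_pos ha k).ne' (besselEntire_modeParam ha k) hs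
  rw [eigFun_eq ha, eigVal_eq, mul_left_comm, ← h, ← integral_const_mul]
  refine integral_congr_ae (ae_of_all _ fun t => ?_)
  simp only [eigFun_eq ha]
  ring

lemma eigFun_mem_eigenspace {a : ℝ} (ha : -1 < a) (k : ℕ+) :
    (memLp_eigFun ha k).toLp (eigFun a k) ∈
      Module.End.eigenspace (covOperator ha : Module.End ℝ (Ha a)) (eigVal a k) := by
  rw [Module.End.mem_eigenspace_iff]
  refine Lp.ext ?_
  change covOperator ha _ =ᵐ[weightMeasure a] _
  filter_upwards [coeFn_covOperator ha ((memLp_eigFun ha k).toLp (eigFun a k)),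
    Lp.coeFn_smul (eigVal a k) ((memLp_eigFun ha k).toLp (eigFun a k)),
    (memLp_eigFun ha k).coeFn_toLp, ae_nonneg_weightMeasure a] with s h1 h2 h3 hs
  rw [h1, h2, Pi.smul_apply, h3, smul_eq_mul, ← integral_K0_mul_eigFun ha k hs, covFun,
    ← integral_weightMeasure]
  refine integral_congr_ae ?_
  filter_upwards [(memLp_eigFun ha k).coeFn_toLp] with t ht
  rw [ht]

lemma covFun_ae_eq_of_mem_eigenspace {a : ℝ} (ha : -1 < a) {μ : ℝ} {f : Ha a}
    (hf : f ∈ Module.End.eigenspace (covOperator ha : Module.End ℝ (Ha a)) μ) :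
    ∀ᵐ s ∂weightMeasure a, covFun a f s = μ * f s := by
  rw [Module.End.mem_eigenspace_iff] at hf
  change covOperator ha f = μ • f at hf
  filter_upwards [coeFn_covOperator ha f, Lp.coeFn_smul μ f] with s h1 h2
  rw [← h1, hf, h2, Pi.smul_apply, smul_eq_mul]

lemma eigenspace_eq_span {a : ℝ} (ha : -1 < a) (k : ℕ+) :
    Module.End.eigenspace (covOperator ha : Module.End ℝ (Ha a)) (eigVal a k) =
      Submodule.span ℝ {(memLp_eigFun ha k).toLp (eigFun a k)} := by
  refine le_antisymm (fun f hf => ?_) ?_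
  · have hc := modeParam_pos ha k
    have hν := order_pos ha
    have e : order a ^ 2 / eigVal a k = modeParam a k := by
      rw [eigVal_eq, div_div_cancel₀ (by positivity)]
    obtain ⟨r, hr⟩ := exists_eq_modeFun_of_eigen ha f (eigVal_pos ha k).ne'
      (covFun_ae_eq_of_mem_eigenspace ha hf) (by rw [e]; exact besselEntire_modeParam ha k)
    refine Submodule.mem_span_singleton.2 ⟨r / modeScale a k, Lp.ext ?_⟩
    filter_upwards [hr, (memLp_eigFun ha k).coeFn_toLp,
      Lp.coeFn_smul (r / modeScale a k) ((memLp_eigFun ha k).toLp (eigFun a k))] with s h1 h2 h3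
    rw [h1, h3, Pi.smul_apply, h2, smul_eq_mul, eigFun_eq ha, e]
    have := modeScale_ne_zero ha k
    field_simp
  · rw [Submodule.span_singleton_le_iff_mem]
    exact eigFun_mem_eigenspace ha k

lemma hasEigenvalue_covOperator_iff {a : ℝ} (ha : -1 < a) (μ : ℝ) :
    Module.End.HasEigenvalue (covOperator ha : Module.End ℝ (Ha a)) μ ↔
      ∃ k : ℕ+, μ = eigVal a k := by
  have hν := order_pos ha
  constructor
  · intro h
    obtain ⟨f, hf, hf0⟩ := h.exists_hasEigenvector
    have hae := covFun_ae_eq_of_mem_eigenspace ha hf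
    have hμ : μ ≠ 0 := by
      rintro rfl
      exact hf0 (eq_zero_of_covFun_ae_eq_zero ha f (by simpa using hae))
    have h0 := besselEntire_eq_zero_of_eigen ha f hμ hae hf0
    set c := order a ^ 2 / μ with hc
    -- φ_ν has no zero in (-∞, 0], so c > 0 and 2√c is a positive zero of J_ν.
    have hcpos : 0 < c := by
      by_contra! hle
      exact (besselEntire_pos_of_nonpos (μ := order a) (by linarith) hle).ne' h0
    have hz : (2 * √c) ^ 2 / 4 = c := by rw [mul_pow, Real.sq_sqrt hcpos.le]; ring
    have hpos : 0 < 2 * √c := by positivity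
    obtain ⟨k, hk⟩ := exists_eq_besselZero ha hpos
      ((besselJ_eq_zero_iff hpos _).2 (by rw [hz]; exact h0))
    refine ⟨k, ?_⟩
    rw [eigVal_eq, modeParam, hk, hz, hc, div_div_cancel₀ (by positivity)]
  · rintro ⟨k, rfl⟩
    exact Module.End.hasEigenvalue_of_hasEigenvector
      ⟨eigFun_mem_eigenspace ha k, (orthonormal_eigFun ha).ne_zero k⟩

lemma besselJ_order_sub_one_ne_zero {a : ℝ} (ha : -1 < a) (k : ℕ+) :
    besselJ (order a - 1) (besselZero (order a) k) ≠ 0 := by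
  rw [Ne, besselJ_eq_zero_iff (besselZero_pos ha k)]
  exact besselEntire_sub_one_ne_zero ha (besselEntire_modeParam ha k)

lemma range_besselZero {a : ℝ} (ha : -1 < a) :
    range (fun k : ℕ+ => besselZero (order a) k) = {x : ℝ | 0 < x ∧ besselJ (order a) x = 0} := by
  ext x
  constructor
  · rintro ⟨k, rfl⟩
    exact ⟨besselZero_pos ha k, besselJ_besselZero ha k⟩
  · rintro ⟨hx, h0⟩
    exact exists_eq_besselZero ha hx h0

/-! ### The case a = 1 -/

lemma eigVal_one (k : ℕ) : eigVal 1 k = 1 / (k * Real.pi) ^ 2 := by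
  rw [eigVal, order_one, besselZero_half, div_pow]
  norm_num

lemma eigFun_one (k : ℕ+) (t : ℝ) :
    eigFun 1 k t = (-1) ^ (k : ℕ) * √2 * Real.sin (k * Real.pi * Real.exp (-t)) := by
  have hpi := Real.pi_pos
  have hk : (0 : ℝ) < k := by exact_mod_cast k.pos
  have hz : (0 : ℝ) < k * Real.pi := by positivity
  have h1 := besselEntire_half (x := k * Real.pi * Real.exp (-t))
  have h2 := besselEntire_neg_half (x := k * Real.pi)
  have e2 : modeParam 1 k = (k * Real.pi) ^ 2 / 4 := by
    rw [modeParam, order_one, besselZero_half]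
  have e1 : modeParam 1 k * Real.exp (-((1 + 1) * t)) =
      (k * Real.pi * Real.exp (-t)) ^ 2 / 4 := by
    rw [e2, show -((1 + 1) * t) = (2 : ℕ) * -t by push_cast; ring, Real.exp_nat_mul]
    ring
  rw [eigFun_eq (by norm_num), modeScale, modeFun, e1, e2, order_one, besselZero_half, h2,
    Real.cos_nat_mul_pi]
  have hs : √Real.pi ≠ 0 := by positivity
  have hhalf : √(1 / 2 : ℝ) = √2 / 2 := by
    rw [Real.sqrt_div zero_le_one, Real.sqrt_one, ← Real.sqrt_div_self']
  have h22 : √2 * √2 = (2 : ℝ) := Real.mul_self_sqrt (by norm_num)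
  -- The sign comes from cos(kπ) = (-1)^k in the denominator; it is its own inverse.
  have hm : ((-1 : ℝ) ^ (k : ℕ)) * (-1) ^ (k : ℕ) = 1 := by
    rw [← mul_pow]; norm_num
  have hm0 : ((-1 : ℝ) ^ (k : ℕ)) ≠ 0 := pow_ne_zero _ (by norm_num)
  have hs2 : √2 ≠ (0 : ℝ) := by positivity
  rw [hhalf, div_mul_eq_mul_div, div_eq_iff (by positivity)]
  set S := Real.sin (k * Real.pi * Real.exp (-t))
  linear_combination (1 / 2) * h1 - (S / (2 * √Real.pi)) * ((-1) ^ (k : ℕ) * (-1) ^ (k : ℕ)) * h22 -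
    (S / √Real.pi) * hm

lemma integral_K0_mul_sin (k : ℕ+) {s : ℝ} (hs : 0 ≤ s) :
    ∫ t in Ioi 0, K0 s t * Real.sin (k * Real.pi * Real.exp (-t)) * Real.exp (-t) =
      1 / (k * Real.pi) ^ 2 * Real.sin (k * Real.pi * Real.exp (-s)) := by
  have h := integral_K0_mul_eigFun (a := 1) (by norm_num) k hs
  have hr : (-1 : ℝ) ^ (k : ℕ) * √2 ≠ 0 :=
    mul_ne_zero (pow_ne_zero _ (by norm_num)) (by positivity)
  apply mul_left_cancel₀ hr
  rw [eigVal_one, eigFun_one, mul_left_comm] at h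
  rw [← h, ← integral_const_mul]
  refine integral_congr_ae (ae_of_all _ fun t => ?_)
  simp only [eigFun_one, one_mul]
  ring

end ExpTest

end

theorem mainTheorem6 :
    (∀ a : ℝ, -1 < a →
      -- the positive zeros of `J_ν` form the infinite ascending sequence `z_{ν,1} < z_{ν,2} < …`
      StrictMono (ExpTest.besselZero (ExpTest.order a)) ∧
      Set.range (fun k : ℕ+ => ExpTest.besselZero (ExpTest.order a) k) =
        {x : ℝ | 0 < x ∧ ExpTest.besselJ (ExpTest.order a) x = 0} ∧
      (∀ k : ℕ+, ExpTest.besselJ (ExpTest.order a - 1)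
        (ExpTest.besselZero (ExpTest.order a) k) ≠ 0) ∧
      -- the integral operator with kernel `K₀` is well defined on `H_a`, and its eigenvalues,
      -- in decreasing order, are exactly the `λ_k(a)`; all are simple, with the normalised
      -- eigenfunctions `f_{k,a}`
      ∃ T : ExpTest.Ha a →L[ℝ] ExpTest.Ha a, ExpTest.IsCovOperator a T ∧
        (∀ k : ℕ+, 0 < ExpTest.eigVal a k) ∧
        StrictAnti (fun k : ℕ+ => ExpTest.eigVal a k) ∧
        (∀ μ : ℝ, Module.End.HasEigenvalue (T : Module.End ℝ (ExpTest.Ha a)) μ ↔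
          ∃ k : ℕ+, μ = ExpTest.eigVal a k) ∧
        (∃ hf : ∀ k : ℕ+, MeasureTheory.MemLp (ExpTest.eigFun a k) 2 (ExpTest.weightMeasure a),
          Orthonormal ℝ (fun k : ℕ+ => (hf k).toLp (ExpTest.eigFun a k)) ∧
          ∀ k : ℕ+, Module.End.eigenspace (T : Module.End ℝ (ExpTest.Ha a)) (ExpTest.eigVal a k) =
            Submodule.span ℝ {(hf k).toLp (ExpTest.eigFun a k)}) ∧
        -- the homogeneous Fredholm equation holds at every point
        (∀ k : ℕ+, ∀ x : ℝ, 0 < x →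
          ∫ t in Set.Ioi 0, ExpTest.K0 x t * ExpTest.eigFun a k t * Real.exp (-(a * t)) =
            ExpTest.eigVal a k * ExpTest.eigFun a k x)) ∧
    -- the case `a = 1`
    (∀ k : ℕ+,
      ExpTest.eigVal 1 k = 1 / (k * Real.pi) ^ 2 ∧
      (∀ t : ℝ, 0 < t →
        ExpTest.eigFun 1 k t = (-1) ^ (k : ℕ) * √2 * Real.sin (k * Real.pi * Real.exp (-t))) ∧
      ∀ x : ℝ, 0 < x →
        ∫ t in Set.Ioi 0,
            ExpTest.K0 x t * Real.sin (k * Real.pi * Real.exp (-t)) * Real.exp (-t) =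
          1 / (k * Real.pi) ^ 2 * Real.sin (k * Real.pi * Real.exp (-x))) := by
  refine ⟨fun a ha => ⟨ExpTest.strictMono_besselZero ha, ExpTest.range_besselZero ha,
    ExpTest.besselJ_order_sub_one_ne_zero ha, ExpTest.covOperator ha,
    ExpTest.isCovOperator_covOperator ha, ExpTest.eigVal_pos ha, ExpTest.strictAnti_eigVal ha,
    ExpTest.hasEigenvalue_covOperator_iff ha,
    ⟨ExpTest.memLp_eigFun ha, ExpTest.orthonormal_eigFun ha, ExpTest.eigenspace_eq_span ha⟩,
    fun k x hx => ExpTest.integral_K0_mul_eigFun ha k hx.le⟩,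
    fun k => ⟨ExpTest.eigVal_one k, fun t _ => ExpTest.eigFun_one k t,
      fun x hx => ExpTest.integral_K0_mul_sin k hx.le⟩⟩
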